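/- Let $d\ge 2$ be an integer and, for $\alpha\in\mathbb R$, put $$ C(d,\alpha)=\begin{cases}\displaystyle\min_{k\in\mathbb N_0}\frac{\bigl(4k(k+d-2)+(d-4-\alpha)(d+\alpha)\bigr)^2}{4\bigl(4k(k+d-2)+(d-4-\alpha)^2\bigr)}, & d-\alpha-4\neq 0,\\[2mm] \min\bigl((d-2)^2,\;d-1\bigr), & d-\alpha-4=0,\end{cases} $$ where in the first case the minimum over $k$ is attained. Then the following hold. 1. For every $\alpha\in\mathbb R$ and every complex-valued $\psi\in C_0^\infty(\mathbb R^d\setminus\{0\})$ (smooth, with compact support contained in $\mathbb R^d\setminus\{0\}$), both integrals below are finite and $$ \int_{\mathbb R^d}\frac{|\Delta\psi(x)|^2}{|x|^{\alpha}}\,dx\;\ge\; C(d,\alpha)\int_{\mathbb R^d}\frac{|\nabla\psi(x)|^2}{|x|^{\alpha+2}}\,dx ,\qquad |\nabla\psi|^2=\sum_{i=1}^d|\partial_i\psi|^2 . $$ 2. The constant is optimal: for every $\alpha\in\mathbb R$, if a real number $C$ satisfies $\int_{\mathbb R^d}|\Delta\psi|^2|x|^{-\alpha}\,dx\ge C\int_{\mathbb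 R^d}|\nabla\psi|^2|x|^{-\alpha-2}\,dx$ for all $\psi\in C_0^\infty(\mathbb R^d\setminus\{0\})$, then $C\le C(d,\alpha)$. 3. For $\alpha=0$ it takes the classical values $C(2,0)=0$, $C(3,0)=\tfrac{25}{36}$, $C(4,0)=3$, and $C(d,0)=\tfrac{d^2}{4}$ for $d\ge5$. -/

import Mathlib

open MeasureTheory
open scoped ContDiff

noncomputable section

/-- `ψ ∈ C₀^∞(ℝ^d ∖ {0})`, complex valued: `ψ` is smooth and its support is a compact subset of
`ℝ^d ∖ {0}`. -/
structure IsTestAwayFromZero {d : ℕ} (ψ : EuclideanSpace ℝ (Fin d) → ℂ) : Prop where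
  smooth : ContDiff ℝ ∞ ψ
  compactSupport : HasCompactSupport ψ
  zero_notMem : (0 : EuclideanSpace ℝ (Fin d)) ∉ tsupport ψ

/-- `|∇ψ(x)|² = ∑ᵢ |∂ᵢψ(x)|²`, the squared Hermitian length of the complex gradient. -/
def gradSq {d : ℕ} (ψ : EuclideanSpace ℝ (Fin d) → ℂ) (x : EuclideanSpace ℝ (Fin d)) : ℝ :=
  ∑ i : Fin d, ‖fderiv ℝ ψ x (EuclideanSpace.single i 1)‖ ^ 2

/-- The integrand `|Δψ(x)|² / |x|^α`. -/
def rellichIntegrand {d : ℕ} (α : ℝ) (ψ : EuclideanSpace ℝ (Fin d) → ℂ)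
    (x : EuclideanSpace ℝ (Fin d)) : ℝ :=
  ‖Laplacian.laplacian ψ x‖ ^ 2 / ‖x‖ ^ α

/-- The integrand `|∇ψ(x)|² / |x|^(α+2)`. -/
def hardyIntegrand {d : ℕ} (α : ℝ) (ψ : EuclideanSpace ℝ (Fin d) → ℂ)
    (x : EuclideanSpace ℝ (Fin d)) : ℝ :=
  gradSq ψ x / ‖x‖ ^ (α + 2)

/-- The eigenvalue `k(k+d-2)` of minus the Laplace-Beltrami operator on the unit sphere. -/
def sphereEigenvalue (d k : ℕ) : ℝ := (k : ℝ) * ((k : ℝ) + (d : ℝ) - 2)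

/-- `(4 k(k+d-2) + (d-4-α)(d+α))² / (4 (4 k(k+d-2) + (d-4-α)²))`. -/
def hardyRellichQuotient (d : ℕ) (α : ℝ) (k : ℕ) : ℝ :=
  (4 * sphereEigenvalue d k + ((d : ℝ) - 4 - α) * ((d : ℝ) + α)) ^ 2 /
    (4 * (4 * sphereEigenvalue d k + ((d : ℝ) - 4 - α) ^ 2))

/-- The constant `C(d, α)`. -/
def hardyRellichConst (d : ℕ) (α : ℝ) : ℝ :=
  if (d : ℝ) - α - 4 ≠ 0 then ⨅ k : ℕ, hardyRellichQuotient d α k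
  else min (((d : ℝ) - 2) ^ 2) ((d : ℝ) - 1)

end

-- Put p = -4 - α, σ = (d - 4 - α)/2, τ = (d + α)/2, and work in L²(|x|^p dx), where the two
-- integrals are the squared norms of |x|²Δψ and |x|∇ψ. Integration by parts makes T = x·∇ + σ
-- antisymmetric, while L, minus the spherical Laplacian written through generators of rotations, is
-- symmetric, nonnegative and commutes with T. The polar form of the Laplacian reads |x|²Δ = T² + (α
-- + 2)T - M with M = L + στ. Expanding the squares and using α + 2 = τ - σ gives
-- (`TestSpace.integral_rellich`, `TestSpace.integral_hardy`) Rellich = ‖T²ψ‖² + 2⟨L Tψ, Tψ⟩ + (σ² +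
-- τ²)‖Tψ‖² + ‖Mψ‖², Hardy = ‖Tψ‖² + σ²‖ψ‖² + ⟨Lψ, ψ⟩.
--
-- Hence C is admissible as soon as C ≤ σ² + τ² and C(λ + σ²) ≤ (λ + στ)² at every eigenvalue λ =
-- k(k + d - 2) of L (`TestSpace.mul_integral_hardy_le`). If σ ≠ 0 the case k = 0 already says C ≤
-- τ², so only the second condition matters and the best C is the minimum of the quotients. If σ = 0
-- the case k = 0 is void, and the first condition supplies the bound τ² = (d - 2)².
--
-- Passing from eigenvalues to operators needs no spectral theorem, only density of the
-- eigenvectors: `LinearMap.IsSymmetric.quadratic_nonneg_of_dense_eigenspaces`. Density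
-- (`topologicalClosure_iSup_eigenspace_L`) follows from Stone-Weierstrass and the fact that a
-- radial function times a homogeneous function of degree n is killed by a product of factors L -
-- λ_j.
--
-- For optimality, `TestSpace.harmonicBump` carries one harmonic of degree k and a profile η(log r /
-- n). On it T acts as n⁻¹ times differentiation of η, so as n → ∞ only the conditions above
-- survive; for σ = 0 and k = 0 the leading terms vanish and the next order gives C ≤ (d - 2)².

local notation "𝔼" n:max => EuclideanSpace ℝ (Fin n)

/-! ### Symmetric operators with dense eigenvectors -/

section SpectralCalculus

open Module.End UniformSpace

variable {E : Type*} [SeminormedAddCommGroup E] [InnerProductSpace ℂ E]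

theorem LinearMap.IsSymmetric.inner_eigenspace_eq_zero {L : E →ₗ[ℂ] E} (hL : L.IsSymmetric)
    {a b : ℝ} (hab : a ≠ b) {u v : E} (hu : u ∈ eigenspace L (a : ℂ))
    (hv : v ∈ eigenspace L (b : ℂ)) : inner ℂ u v = 0 := by
  rw [mem_eigenspace_iff] at hu hv
  have h := hL u v
  rw [hu, hv, inner_smul_left, inner_smul_right, Complex.conj_ofReal] at h
  have h' : ((a : ℂ) - b) * inner ℂ u v = 0 := by linear_combination h
  refine (mul_eq_zero.1 h').resolve_left fun h0 => hab ?_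
  exact_mod_cast sub_eq_zero.1 h0

/-- A quadratic polynomial which is nonnegative on the eigenvalues of a symmetric operator with a
dense set of eigenvectors has a nonnegative quadratic form. -/
theorem LinearMap.IsSymmetric.quadratic_nonneg_of_dense_eigenspaces {L : E →ₗ[ℂ] E}
    (hL : L.IsSymmetric) {lam : ℕ → ℝ} (hlam : Function.Injective lam)
    (hd : (⨆ j, eigenspace L (lam j : ℂ)).topologicalClosure = ⊤) {b c : ℝ}
    (hp : ∀ j, 0 ≤ lam j ^ 2 + b * lam j + c) (f : E) :
    0 ≤ ‖L f‖ ^ 2 + b * (inner ℂ (L f) f).re + c * ‖f‖ ^ 2 := by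
  -- The space need be neither separated nor complete, so the eigenspaces are pushed into its
  -- completion, where their closures form a Hilbert sum. `L` may be unbounded and is never
  -- extended.
  let ι : E →ₗᵢ[ℂ] Completion E := Completion.toComplₗᵢ
  have hι : ∀ u v, inner ℂ (ι u) (ι v) = inner ℂ u v := fun u v => ι.inner_map_map u v
  let W : ℕ → Submodule ℂ (Completion E) := fun j =>
    ((eigenspace L (lam j : ℂ)).map ι.toLinearMap).topologicalClosure
  have hWc : ∀ j, CompleteSpace (W j) := fun j =>
    (Submodule.isClosed_topologicalClosure _).completeSpace_coe
  have horth : OrthogonalFamily ℂ (fun j => W j) fun j => (W j).subtypeₗᵢ := by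
    refine OrthogonalFamily.of_pairwise fun i j hij => ?_
    have h : (eigenspace L (lam i : ℂ)).map ι.toLinearMap ⟂
        (eigenspace L (lam j : ℂ)).map ι.toLinearMap := by
      rw [Submodule.isOrtho_iff_inner_eq]
      rintro _ ⟨u, hu, rfl⟩ _ ⟨v, hv, rfl⟩
      exact (hι u v).trans (hL.inner_eigenspace_eq_zero (fun h => hij (hlam h)) hu hv)
    have h1 : W i ⟂ (eigenspace L (lam j : ℂ)).map ι.toLinearMap :=
      Submodule.topologicalClosure_minimal _ h (Submodule.isClosed_orthogonal _)
    exact Submodule.IsOrtho.symm (Submodule.topologicalClosure_minimal _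
      (Submodule.IsOrtho.symm h1) (Submodule.isClosed_orthogonal _))
  have hdense : ⊤ ≤ (⨆ j, W j).topologicalClosure := by
    have h1 := (Completion.denseRange_coe (α := E)).topologicalClosure_map_submodule
      (f := ι.toContinuousLinearMap) hd
    rw [← h1]
    refine Submodule.topologicalClosure_mono ?_
    rw [Submodule.map_iSup]
    exact iSup_mono fun j => Submodule.le_topologicalClosure _
  have hS : IsHilbertSum ℂ (fun j => W j) fun j => (W j).subtypeₗᵢ :=
    IsHilbertSum.mkInternal W horth hdense
  -- `q u j` is the orthogonal projection of `u` onto `W j`; the last clause is Parseval's identity.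
  obtain ⟨q, hqW, hq, hsum⟩ : ∃ q : E → ℕ → Completion E, (∀ u j, q u j ∈ W j) ∧
      (∀ u j, ∀ w ∈ W j, inner ℂ w (q u j) = inner ℂ w (ι u)) ∧
      ∀ u v, HasSum (fun j => inner ℂ (q u j) (q v j)) (inner ℂ u v) := by
    classical
    let U := hS.linearIsometryEquiv
    refine ⟨fun u j => (U (ι u) j : W j), fun u j => (U (ι u) j).2, fun u j w hw => ?_,
      fun u v => ?_⟩
    · have h := lp.inner_single_left (𝕜 := ℂ) j (⟨w, hw⟩ : W j) (U (ι u))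
      rw [← U.symm.inner_map_map, hS.linearIsometryEquiv_symm_apply_single,
        LinearIsometryEquiv.symm_apply_apply] at h
      exact h.symm
    · have h := lp.hasSum_inner (𝕜 := ℂ) (U (ι u)) (U (ι v))
      rwa [U.inner_map_map, hι] at h
  -- Symmetry of `L` gives this when tested against eigenvectors, and continuity extends the test to
  -- their closure.
  have hqL : ∀ j, q (L f) j = (lam j : ℂ) • q f j := by
    intro j
    have key : ∀ w ∈ W j, inner ℂ w (q (L f) j) = inner ℂ w ((lam j : ℂ) • q f j) := by
      intro w hw
      rw [inner_smul_right, hq _ _ _ hw, hq _ _ _ hw]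
      have hcl : IsClosed {w : Completion E | inner ℂ w (ι (L f)) = lam j * inner ℂ w (ι f)} :=
        isClosed_eq (by fun_prop) (by fun_prop)
      refine closure_minimal ?_ hcl hw
      rintro _ ⟨u, hu, rfl⟩
      have hu' : L u = (lam j : ℂ) • u := mem_eigenspace_iff.1 hu
      change inner ℂ (ι u) (ι (L f)) = lam j * inner ℂ (ι u) (ι f)
      rw [hι, hι, ← hL u f, hu', inner_smul_left, Complex.conj_ofReal]
    have h := key _ (sub_mem (hqW (L f) j) ((W j).smul_mem (lam j : ℂ) (hqW f j)))
    rwa [← sub_eq_zero, ← inner_sub_right, inner_self_eq_zero, sub_eq_zero] at h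
  have h1 := (Complex.hasSum_re (hsum (L f) (L f)))
  have h2 := (Complex.hasSum_re (hsum (L f) f)).mul_left b
  have h3 := (Complex.hasSum_re (hsum f f)).mul_left c
  have hself : ∀ u : E, (inner ℂ u u : ℂ).re = ‖u‖ ^ 2 := fun u =>
    inner_self_eq_norm_sq (𝕜 := ℂ) u
  rw [hself] at h1 h3
  refine ((h1.add h2).add h3).nonneg fun j => ?_
  set y := q f j with hy'
  have hy : (inner ℂ y y : ℂ).re = ‖y‖ ^ 2 := inner_self_eq_norm_sq (𝕜 := ℂ) y
  simp only [hqL, ← hy', inner_smul_left, inner_smul_right, Complex.conj_ofReal, Complex.re_ofReal_mul, hy]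
  have := mul_nonneg (hp j) (sq_nonneg ‖y‖)
  linarith

/-- A vector annihilated by `∏ (L - λⱼ)` with distinct `λⱼ` is a sum of eigenvectors. -/
theorem mem_iSup_eigenspace_of_prod_eq_zero {V : Type*} [AddCommGroup V] [Module ℂ V]
    (L : Module.End ℂ V) {lam : ℕ → ℂ} (hlam : Function.Injective lam) (n : ℕ) {v : V}
    (hv : Polynomial.aeval L (∏ j ∈ Finset.range n, (Polynomial.X - Polynomial.C (lam j))) v = 0) :
    v ∈ ⨆ j, eigenspace L (lam j) := by
  induction n generalizing v with
  | zero => simp at hv; simp [hv]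
  | succ n ih =>
    rw [Finset.prod_range_succ] at hv
    -- Distinct roots make the factors coprime, so the kernel of the product is the sum of the
    -- kernels.
    have hc : IsCoprime (∏ j ∈ Finset.range n, (Polynomial.X - Polynomial.C (lam j)))
        (Polynomial.X - Polynomial.C (lam n)) := by
      refine IsCoprime.prod_left fun j hj => ?_
      exact Polynomial.isCoprime_X_sub_C_of_isUnit_sub
        (sub_ne_zero.2 fun h => (Finset.mem_range.1 hj).ne (hlam h)).isUnit
    have hv' : v ∈ (Polynomial.aeval L ((∏ j ∈ Finset.range n,
        (Polynomial.X - Polynomial.C (lam j))) * (Polynomial.X - Polynomial.C (lam n)))).ker := hv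
    rw [← Polynomial.sup_ker_aeval_eq_ker_aeval_mul_of_coprime L hc, Submodule.mem_sup] at hv'
    obtain ⟨y, hy, z, hz, rfl⟩ := hv'
    refine add_mem (ih hy) (Submodule.mem_iSup_of_mem n ?_)
    rw [mem_eigenspace_iff]
    have hz' : L z - lam n • z = 0 := by simpa using hz
    exact sub_eq_zero.1 hz'

end SpectralCalculus

/-! ### Expansion of the square of the operator -/

section Abstract

variable {E : Type*} [SeminormedAddCommGroup E] [InnerProductSpace ℂ E]

/-- Expansion of the square of `T² + b T - M`, with `T` antisymmetric, `M` symmetric and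
commuting. -/
theorem norm_sq_quadratic_antisymm {T M : E →ₗ[ℂ] E}
    (hT : ∀ f g, inner ℂ (T f) g = - inner ℂ f (T g)) (hM : M.IsSymmetric)
    (hTM : ∀ f, T (M f) = M (T f)) (b : ℝ) (f : E) :
    ‖T (T f) + (b : ℂ) • T f - M f‖ ^ 2 =
      ‖T (T f)‖ ^ 2 + 2 * (inner ℂ (M (T f)) (T f)).re + b ^ 2 * ‖T f‖ ^ 2 + ‖M f‖ ^ 2 := by
  have hself : ∀ u : E, (inner ℂ u u : ℂ).re = ‖u‖ ^ 2 := fun u =>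
    inner_self_eq_norm_sq (𝕜 := ℂ) u
  have hconj : ∀ u v : E, (inner ℂ u v : ℂ).re = (inner ℂ v u : ℂ).re := fun u v =>
    inner_re_symm (𝕜 := ℂ) u v
  have h1 : ∀ u : E, (inner ℂ (T u) u : ℂ).re = 0 := by
    intro u
    have h := congrArg Complex.re (hT u u)
    rw [Complex.neg_re, hconj u] at h
    linarith
  -- The composite of `T` and `M` is antisymmetric, so this cross term has no real part. The only
  -- cross term that survives, between T²f and Mf, turns into ⟨M T f, T f⟩.
  have h2 : (inner ℂ (M f) (T f) : ℂ).re = 0 := by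
    have h := congrArg Complex.re (hT (M f) f)
    rw [hTM, Complex.neg_re, hM, hconj] at h
    linarith
  have h3 : (inner ℂ (T (T f)) (M f) : ℂ).re = - (inner ℂ (M (T f)) (T f)).re := by
    have h := congrArg Complex.re (hT (T f) (M f))
    rwa [Complex.neg_re, hTM, hconj (T f)] at h
  rw [← hself, ← hself, ← hself, ← hself]
  simp only [inner_add_left, inner_add_right, inner_sub_left, inner_sub_right, inner_smul_left,
    inner_smul_right, Complex.conj_ofReal, Complex.add_re, Complex.sub_re, Complex.re_ofReal_mul]
  rw [h1 (T f), hconj (T f) (T (T f)), h1 (T f), h2, hconj (T f) (M f), h2, h3,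
    hconj (M f) (T (T f)), h3]
  ring

end Abstract

/-! ### Test functions and integration by parts along linear fields -/

section TestFunctions

variable {d : ℕ} {f g : 𝔼 d → ℂ}

/-- Smoothness at the origin is automatic because the function vanishes near it. This lets test
functions be multiplied by factors singular at 0, such as powers of the norm. -/
theorem IsTestAwayFromZero.of_contDiffOn (hf : ContDiffOn ℝ ∞ f {0}ᶜ) {a b : ℝ} (ha : 0 < a)
    (h : ∀ x, f x ≠ 0 → a ≤ ‖x‖ ∧ ‖x‖ ≤ b) : IsTestAwayFromZero f := by
  have hcl : IsClosed {x : 𝔼 d | a ≤ ‖x‖ ∧ ‖x‖ ≤ b} :=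
    (isClosed_le continuous_const continuous_norm).inter
      (isClosed_le continuous_norm continuous_const)
  have hts : tsupport f ⊆ {x : 𝔼 d | a ≤ ‖x‖ ∧ ‖x‖ ≤ b} := closure_minimal h hcl
  have h0 : (0 : 𝔼 d) ∉ tsupport f := fun h0 => by
    have := (hts h0).1
    rw [norm_zero] at this
    linarith
  refine ⟨contDiff_iff_contDiffAt.2 fun x => ?_, ?_, h0⟩
  · by_cases hx : x = 0
    · subst hx
      have : f =ᶠ[nhds 0] 0 := notMem_tsupport_iff_eventuallyEq.1 h0
      exact contDiffAt_const.congr_of_eventuallyEq this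
    · exact hf.contDiffAt (isOpen_compl_singleton.mem_nhds hx)
  · refine IsCompact.of_isClosed_subset (isCompact_closedBall (0 : 𝔼 d) b)
      (isClosed_tsupport f) fun x hx => ?_
    simpa using (hts hx).2

namespace IsTestAwayFromZero

theorem exists_annulus (hf : IsTestAwayFromZero f) :
    ∃ a b : ℝ, 0 < a ∧ ∀ x ∈ tsupport f, a ≤ ‖x‖ ∧ ‖x‖ ≤ b := by
  obtain ⟨a, ha, hab⟩ := Metric.isOpen_iff.1 (isClosed_tsupport f).isOpen_compl 0 hf.zero_notMem
  obtain ⟨b, hb⟩ := hf.compactSupport.isBounded.exists_norm_le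
  refine ⟨a, b, ha, fun x hx => ⟨?_, hb x hx⟩⟩
  by_contra! h
  exact hab (by simpa using h) hx

theorem zero_fun : IsTestAwayFromZero (0 : 𝔼 d → ℂ) :=
  ⟨contDiff_const, HasCompactSupport.zero, by simp⟩

theorem add (hf : IsTestAwayFromZero f) (hg : IsTestAwayFromZero g) :
    IsTestAwayFromZero (f + g) :=
  ⟨hf.smooth.add hg.smooth, hf.compactSupport.add hg.compactSupport, fun h =>
    ((tsupport_add f g).trans subset_rfl h).elim hf.zero_notMem hg.zero_notMem⟩

theorem mul_left (hf : IsTestAwayFromZero f) (hg : ContDiffOn ℝ ∞ g {0}ᶜ) :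
    IsTestAwayFromZero (fun x => g x * f x) := by
  obtain ⟨a, b, ha, hab⟩ := hf.exists_annulus
  exact of_contDiffOn (hg.mul hf.smooth.contDiffOn) ha fun x hx =>
    hab x (subset_tsupport f fun h => hx (by simp [h]))

theorem const_smul (hf : IsTestAwayFromZero f) (c : ℂ) : IsTestAwayFromZero (c • f) :=
  hf.mul_left (g := fun _ => c) contDiffOn_const

theorem star_comp (hf : IsTestAwayFromZero f) :
    IsTestAwayFromZero (fun x => (starRingEnd ℂ) (f x)) := by
  obtain ⟨a, b, ha, hab⟩ := hf.exists_annulus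
  refine of_contDiffOn (Complex.conjCLE.contDiff.comp hf.smooth).contDiffOn ha fun x hx =>
    hab x (subset_tsupport f fun h => hx (by simp [h]))

theorem continuous (hf : IsTestAwayFromZero f) : Continuous f := hf.smooth.continuous

theorem differentiable (hf : IsTestAwayFromZero f) : Differentiable ℝ f :=
  hf.smooth.differentiable (by simp)

theorem integrable (hf : IsTestAwayFromZero f) : Integrable f :=
  hf.continuous.integrable_of_hasCompactSupport hf.compactSupport

theorem eq_zero (hf : IsTestAwayFromZero f) : f 0 = 0 :=
  image_eq_zero_of_notMem_tsupport hf.zero_notMem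

end IsTestAwayFromZero

/-- The derivative of `f` along the linear vector field `x ↦ A x`. -/
noncomputable def linDeriv (A : 𝔼 d →L[ℝ] 𝔼 d) (f : 𝔼 d → ℂ) (x : 𝔼 d) : ℂ := fderiv ℝ f x (A x)

theorem IsTestAwayFromZero.linDeriv (hf : IsTestAwayFromZero f) (A : 𝔼 d →L[ℝ] 𝔼 d) :
    IsTestAwayFromZero (linDeriv A f) := by
  obtain ⟨a, b, ha, hab⟩ := hf.exists_annulus
  refine of_contDiffOn (ContDiff.contDiffOn ?_) ha fun x hx => hab x ?_
  · exact (hf.smooth.fderiv_right (m := ∞) (by simp)).clm_apply A.contDiff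
  · refine tsupport_fderiv_subset ℝ (subset_tsupport _ fun h => hx ?_)
    simp [_root_.linDeriv, h]

/-- The divergence of the vector field `x ↦ A x`. -/
noncomputable def divergence (A : 𝔼 d →L[ℝ] 𝔼 d) : ℝ := ∑ i, A (EuclideanSpace.single i 1) i

theorem IsTestAwayFromZero.integral_linDeriv (hf : IsTestAwayFromZero f) (A : 𝔼 d →L[ℝ] 𝔼 d) :
    ∫ x, _root_.linDeriv A f x = - (divergence A : ℂ) * ∫ x, f x := by
  let ℓ : Fin d → 𝔼 d →L[ℝ] ℝ := fun i => (EuclideanSpace.proj i).comp A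
  have hℓ : ∀ i x, ℓ i x = A x i := fun i x => rfl
  have hpt : ∀ x, _root_.linDeriv A f x =
      ∑ i, (ℓ i x : ℂ) * fderiv ℝ f x (EuclideanSpace.single i 1) := by
    intro x
    have hx : A x = ∑ i, A x i • EuclideanSpace.single i (1 : ℝ) := by
      simpa using ((EuclideanSpace.basisFun (Fin d) ℝ).sum_repr (A x)).symm
    rw [_root_.linDeriv]
    conv_lhs => rw [hx]
    simp [hℓ]
  have hc : ∀ i, ContDiff ℝ ∞ fun x => (ℓ i x : ℂ) := fun i =>
    Complex.ofRealCLM.contDiff.comp (ℓ i).contDiff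
  have hfd : ∀ i x (v : 𝔼 d), fderiv ℝ (fun x => (ℓ i x : ℂ)) x v = (ℓ i v : ℂ) := by
    intro i x v
    have : HasFDerivAt (fun x => (ℓ i x : ℂ)) (Complex.ofRealCLM.comp (ℓ i)) x :=
      (Complex.ofRealCLM.comp (ℓ i)).hasFDerivAt
    rw [this.fderiv]
    rfl
  have hdv : ∀ v : 𝔼 d, IsTestAwayFromZero (fun x => fderiv ℝ f x v) := by
    intro v
    obtain ⟨a, b, ha, hab⟩ := hf.exists_annulus
    refine of_contDiffOn (ContDiff.contDiffOn ?_) ha fun x hx => hab x ?_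
    · exact (hf.smooth.fderiv_right (m := ∞) (by simp)).clm_apply contDiff_const
    · refine tsupport_fderiv_subset ℝ (subset_tsupport _ fun h => hx ?_)
      simp [h]
  have hI1 : ∀ i, Integrable fun x => (ℓ i x : ℂ) * fderiv ℝ f x (EuclideanSpace.single i 1) :=
    fun i => ((hdv _).mul_left (hc i).contDiffOn).integrable
  simp_rw [hpt]
  rw [integral_finsetSum _ fun i _ => hI1 i]
  have hi : ∀ i, ∫ x, (ℓ i x : ℂ) * fderiv ℝ f x (EuclideanSpace.single i 1) =
      - ((A (EuclideanSpace.single i 1) i : ℝ) : ℂ) * ∫ x, f x := by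
    intro i
    rw [integral_mul_fderiv_eq_neg_fderiv_mul_of_integrable ?_ (hI1 i)
      (hf.mul_left (hc i).contDiffOn).integrable
      (fun x _ => ((hc i).differentiable (by simp)) x) (fun x _ => hf.differentiable x)]
    · simp_rw [hfd, hℓ]
      rw [integral_const_mul, neg_mul]
    · simp_rw [hfd]
      exact hf.integrable.const_mul _
  simp_rw [hi, ← Finset.sum_mul, divergence]
  simp

/-- Integration by parts along a linear vector field, in weighted form. -/
theorem IsTestAwayFromZero.integral_linDeriv_mul (hf : IsTestAwayFromZero f)
    (hg : IsTestAwayFromZero g) (A : 𝔼 d →L[ℝ] 𝔼 d) {w : 𝔼 d → ℝ} (hw : ContDiffOn ℝ ∞ w {0}ᶜ)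
    {c : ℝ} (hwA : ∀ x ≠ 0, fderiv ℝ w x (A x) = c * w x) :
    (∫ x, _root_.linDeriv A f x * g x * w x) + (∫ x, f x * _root_.linDeriv A g x * w x) =
      - ((c + divergence A : ℝ) : ℂ) * ∫ x, f x * g x * w x := by
  have hwc : ContDiffOn ℝ ∞ (fun x => (w x : ℂ)) {0}ᶜ := Complex.ofRealCLM.contDiff.comp_contDiffOn hw
  have hgw : ∀ {u v : 𝔼 d → ℂ}, IsTestAwayFromZero u → IsTestAwayFromZero v →
      IsTestAwayFromZero fun x => u x * v x * w x := by
    intro u v hu hv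
    have := (hu.mul_left hv.smooth.contDiffOn).mul_left hwc
    convert! this using 2
    ring
  have h := (hgw hf hg).integral_linDeriv A
  have hpt : ∀ x, _root_.linDeriv A (fun x => f x * g x * w x) x =
      _root_.linDeriv A f x * g x * w x + f x * _root_.linDeriv A g x * w x
        + (c : ℂ) * (f x * g x * w x) := by
    intro x
    -- The weight may be singular at the origin, but `A 0 = 0` and `f 0 = 0` kill every term there.
    by_cases hx : x = 0
    · subst hx
      simp [_root_.linDeriv, hf.eq_zero]
    have hwx : DifferentiableAt ℝ w x :=
      (hw.contDiffAt (isOpen_compl_singleton.mem_nhds hx)).differentiableAt (by simp)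
    have hwx' : HasFDerivAt (fun x => (w x : ℂ)) (Complex.ofRealCLM.comp (fderiv ℝ w x)) x :=
      Complex.ofRealCLM.hasFDerivAt.comp x hwx.hasFDerivAt
    have : HasFDerivAt (fun x => f x * g x * (w x : ℂ)) _ x :=
      ((hf.differentiable x).hasFDerivAt.mul (hg.differentiable x).hasFDerivAt).mul hwx'
    rw [_root_.linDeriv, this.fderiv]
    simp [_root_.linDeriv, hwA x hx]
    ring
  simp_rw [hpt] at h
  rw [integral_add, integral_add, integral_const_mul] at h
  · push_cast
    linear_combination h
  · exact (hgw (hf.linDeriv A) hg).integrable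
  · exact (hgw hf (hg.linDeriv A)).integrable
  · exact ((hgw (hf.linDeriv A) hg).integrable).add (hgw hf (hg.linDeriv A)).integrable
  · exact (hgw hf hg).integrable.const_mul _

end TestFunctions

/-! ### Pointwise polar decompositions -/

section Pointwise

variable {d : ℕ} {f g : 𝔼 d → ℂ} {x : 𝔼 d}

theorem linDeriv_linDeriv (A B : 𝔼 d →L[ℝ] 𝔼 d) (hf : ContDiffAt ℝ 2 f x) :
    linDeriv A (linDeriv B f) x =
      fderiv ℝ (fderiv ℝ f) x (A x) (B x) + fderiv ℝ f x (B (A x)) := by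
  have h1 : DifferentiableAt ℝ (fderiv ℝ f) x :=
    (hf.fderiv_right (m := 1) (by norm_num [one_add_one_eq_two])).differentiableAt (by simp)
  have h2 : HasFDerivAt (linDeriv B f) _ x := h1.hasFDerivAt.clm_apply B.hasFDerivAt
  rw [linDeriv, h2.fderiv]
  simp [add_comm]

theorem linDeriv_comm {A B : 𝔼 d →L[ℝ] 𝔼 d} (hAB : ∀ y, A (B y) = B (A y))
    (hf : ContDiffAt ℝ 2 f x) : linDeriv A (linDeriv B f) x = linDeriv B (linDeriv A f) x := by
  rw [linDeriv_linDeriv A B hf, linDeriv_linDeriv B A hf, hAB,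
    (hf.isSymmSndFDerivAt (by simp)).eq]

/-- The generator of the rotations in the plane of the coordinates `i` and `j`. -/
noncomputable def rotGen (i j : Fin d) : 𝔼 d →L[ℝ] 𝔼 d :=
  (EuclideanSpace.proj i : 𝔼 d →L[ℝ] ℝ).smulRight (EuclideanSpace.single j 1) -
    (EuclideanSpace.proj j : 𝔼 d →L[ℝ] ℝ).smulRight (EuclideanSpace.single i 1)

theorem rotGen_apply (i j : Fin d) (x : 𝔼 d) :
    rotGen i j x = x i • EuclideanSpace.single j 1 - x j • EuclideanSpace.single i 1 := rfl

theorem inner_rotGen_self (i j : Fin d) (x : 𝔼 d) : inner ℝ x (rotGen i j x) = 0 := by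
  rw [rotGen_apply, inner_sub_right, inner_smul_right, inner_smul_right]
  simp [EuclideanSpace.inner_single_right]
  ring

/-- An antisymmetric matrix has zero diagonal. -/
theorem divergence_rotGen (i j : Fin d) : divergence (rotGen i j) = 0 := by
  refine Finset.sum_eq_zero fun k _ => ?_
  have h := inner_rotGen_self i j (EuclideanSpace.single k (1 : ℝ))
  simpa [EuclideanSpace.inner_single_left] using h

theorem divergence_id : divergence (ContinuousLinearMap.id ℝ (𝔼 d)) = d := by
  simp [divergence]

/-- The Euler field `x · ∇`. -/
noncomputable abbrev euler (f : 𝔼 d → ℂ) : 𝔼 d → ℂ := linDeriv (ContinuousLinearMap.id ℝ (𝔼 d)) f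

/-- Minus the Laplace-Beltrami operator on spheres, as minus the sum of the squares of the
generators of rotations. -/
noncomputable def angularLaplacian (f : 𝔼 d → ℂ) (x : 𝔼 d) : ℂ :=
  -(1 / 2) * ∑ i, ∑ j, linDeriv (rotGen i j) (linDeriv (rotGen i j) f) x

theorem eq_sum_single (x : 𝔼 d) : x = ∑ i, x i • EuclideanSpace.single i (1 : ℝ) := by
  simpa using ((EuclideanSpace.basisFun (Fin d) ℝ).sum_repr x).symm

theorem laplacian_eq_sum_fderiv (f : 𝔼 d → ℂ) (x : 𝔼 d) :
    Laplacian.laplacian f x = ∑ i, fderiv ℝ (fderiv ℝ f) x (EuclideanSpace.single i 1)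
      (EuclideanSpace.single i 1) := by
  rw [InnerProductSpace.laplacian_eq_iteratedFDeriv_orthonormalBasis f
    (EuclideanSpace.basisFun (Fin d) ℝ)]
  simp [iteratedFDeriv_two_apply]

/-- The Laplacian in polar form. -/
theorem norm_sq_mul_laplacian (hf : ContDiffAt ℝ 2 f x) :
    ((‖x‖ ^ 2 : ℝ) : ℂ) * Laplacian.laplacian f x =
      euler (euler f) x + ((d : ℂ) - 2) * euler f x - angularLaplacian f x := by
  have hnorm : ((‖x‖ ^ 2 : ℝ) : ℂ) = ∑ i, (x i : ℂ) ^ 2 := by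
    rw [EuclideanSpace.real_norm_sq_eq]
    push_cast
    rfl
  set H := fderiv ℝ (fderiv ℝ f) x
  set G := fderiv ℝ f x with hG
  let e : Fin d → 𝔼 d := fun i => EuclideanSpace.single i 1
  have he : ∀ i j, e i j = if i = j then 1 else 0 := by
    intro i j
    simp [e, eq_comm]
  have hx : x = ∑ i, x i • e i := eq_sum_single x
  have hGx : G x = ∑ i, (x i : ℂ) * G (e i) := by
    conv_lhs => rw [hx]
    simp
  have hHx : H x x = ∑ i, ∑ j, (x i : ℂ) * x j * H (e i) (e j) := by
    conv_lhs => rw [hx]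
    simp only [map_sum, map_smul, sum_apply, smul_apply, Complex.real_smul, Finset.mul_sum]
    rw [Finset.sum_comm]
    refine Finset.sum_congr rfl fun i _ => Finset.sum_congr rfl fun j _ => ?_
    ring
  have hE : euler f x = G x := rfl
  have hEE : euler (euler f) x = H x x + G x := by
    rw [euler, euler, linDeriv_linDeriv _ _ hf]
    rfl
  have hR : ∀ i j, linDeriv (rotGen i j) (linDeriv (rotGen i j) f) x =
      (x i : ℂ) ^ 2 * H (e j) (e j) + (x j : ℂ) ^ 2 * H (e i) (e i)
      - (x i : ℂ) * x j * H (e i) (e j) - (x j : ℂ) * x i * H (e j) (e i)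
      + (if i = j then (x i : ℂ) * G (e j) else 0) - x j * G (e j)
      + ((if i = j then (x j : ℂ) * G (e i) else 0) - x i * G (e i)) := by
    intro i j
    rw [linDeriv_linDeriv _ _ hf]
    have h1 : rotGen i j x = x i • e j - x j • e i := rfl
    have h2 : rotGen i j (rotGen i j x) = (x i * (if i = j then 1 else 0) - x j) • e j -
        (x i - x j * (if i = j then 1 else 0)) • e i := by
      rw [h1, rotGen_apply]
      simp [e, eq_comm]
    rw [h2, h1, ← hG]
    simp only [map_sub, map_smul, sub_apply, smul_apply,
      Complex.real_smul]
    split_ifs with hij <;> push_cast <;> ring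
  -- The diagonal terms `i = j` lower the first-order coefficient from d to d - 1. Ordered pairs
  -- count each plane of rotation twice, whence the factor 1/2 in `angularLaplacian`.
  have hsum : ∑ i, ∑ j, linDeriv (rotGen i j) (linDeriv (rotGen i j) f) x =
      2 * ((∑ i, (x i : ℂ) ^ 2) * ∑ i, H (e i) (e i)) - 2 * H x x - 2 * (d - 1) * G x := by
    simp_rw [hR]
    have k1 : ∑ i, ∑ j, (x i : ℂ) ^ 2 * H (e j) (e j) =
        (∑ i, (x i : ℂ) ^ 2) * ∑ i, H (e i) (e i) := by
      rw [Finset.sum_mul_sum]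
    have k2 : ∑ i, ∑ j, (x j : ℂ) ^ 2 * H (e i) (e i) =
        (∑ i, (x i : ℂ) ^ 2) * ∑ i, H (e i) (e i) := by
      rw [Finset.sum_comm, k1]
    have k3 : ∑ i, ∑ j, (x j : ℂ) * x i * H (e j) (e i) = H x x := by
      rw [Finset.sum_comm, hHx]
    have k4 : ∑ i : Fin d, ∑ j : Fin d, (x j : ℂ) * G (e j) = d * G x := by
      simp [← hGx]
    have k5 : ∑ i : Fin d, ∑ j : Fin d, (x i : ℂ) * G (e i) = d * G x := by
      rw [Finset.sum_comm, k4]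
    have k6 : ∑ i, ∑ j, (if i = j then (x i : ℂ) * G (e j) else 0) = G x := by
      simp [hGx]
    have k7 : ∑ i, ∑ j, (if i = j then (x j : ℂ) * G (e i) else 0) = G x := by
      simp [hGx]
    simp only [Finset.sum_add_distrib, Finset.sum_sub_distrib]
    rw [k1, k2, k3, ← hHx, k4, k5, k6, k7]
    ring
  rw [angularLaplacian, hsum, hE, hEE, hnorm, laplacian_eq_sum_fderiv]
  change _ * ∑ i, H (e i) (e i) = _
  ring

/-- Decomposition of the gradient into its radial and spherical parts. -/
theorem norm_sq_mul_gradSq (f : 𝔼 d → ℂ) (x : 𝔼 d) :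
    ‖x‖ ^ 2 * gradSq f x = ‖euler f x‖ ^ 2 +
      1 / 2 * ∑ i, ∑ j, ‖linDeriv (rotGen i j) f x‖ ^ 2 := by
  set G := fderiv ℝ f x with hG
  let e : Fin d → 𝔼 d := fun i => EuclideanSpace.single i 1
  have hx : x = ∑ i, x i • e i := eq_sum_single x
  have hGx : euler f x = ∑ i, (x i : ℂ) * G (e i) := by
    change G x = _
    conv_lhs => rw [hx]
    simp
  have hre : ∀ z : ℂ, ‖z‖ ^ 2 = z.re ^ 2 + z.im ^ 2 := by
    intro z
    rw [← Complex.normSq_eq_norm_sq, Complex.normSq_apply]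
    ring
  have hR : ∀ i j, linDeriv (rotGen i j) f x = (x i : ℂ) * G (e j) - x j * G (e i) := by
    intro i j
    change G (x i • e j - x j • e i) = _
    simp
  -- Lagrange's identity, applied below to the real and imaginary parts of the gradient separately.
  have lag : ∀ u : Fin d → ℝ, ∑ i, ∑ j, (x i * u j - x j * u i) ^ 2 =
      2 * ((∑ i, x i ^ 2) * ∑ i, u i ^ 2) - 2 * (∑ i, x i * u i) ^ 2 := by
    intro u
    have k1 : ∑ i, ∑ j, x i ^ 2 * u j ^ 2 = (∑ i, x i ^ 2) * ∑ i, u i ^ 2 := by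
      rw [Finset.sum_mul_sum]
    have k2 : ∑ i, ∑ j, x j ^ 2 * u i ^ 2 = (∑ i, x i ^ 2) * ∑ i, u i ^ 2 := by
      rw [Finset.sum_comm, k1]
    have k3 : ∑ i, ∑ j, (x i * u i) * (x j * u j) = (∑ i, x i * u i) ^ 2 := by
      rw [sq, Finset.sum_mul_sum]
    have k4 : ∀ i j, (x i * u j - x j * u i) ^ 2 =
        x i ^ 2 * u j ^ 2 + x j ^ 2 * u i ^ 2 - 2 * ((x i * u i) * (x j * u j)) := by
      intro i j
      ring
    simp only [k4, Finset.sum_add_distrib, Finset.sum_sub_distrib]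
    rw [k1, k2]
    simp only [← Finset.mul_sum]
    rw [← k3]
    simp only [← Finset.mul_sum]
    ring
  have hnorm : ‖x‖ ^ 2 = ∑ i, x i ^ 2 := EuclideanSpace.real_norm_sq_eq x
  have l1 := lag fun i => (G (e i)).re
  have l2 := lag fun i => (G (e i)).im
  rw [hnorm, hGx, gradSq]
  change _ * ∑ i, ‖G (e i)‖ ^ 2 = _
  simp only [hR, hre, Finset.sum_add_distrib, Complex.re_sum, Complex.im_sum, Complex.sub_re,
    Complex.sub_im, Complex.re_ofReal_mul, Complex.im_ofReal_mul]
  rw [l1, l2]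
  ring

theorem contDiffOn_norm_rpow (p : ℝ) : ContDiffOn ℝ ∞ (fun x : 𝔼 d => ‖x‖ ^ p) {0}ᶜ :=
  fun _ hx => ((contDiffAt_norm ℝ hx).rpow_const_of_ne (norm_ne_zero_iff.2 hx)).contDiffWithinAt

theorem HasDerivAt.hasFDerivAt_comp_norm {F : Type*} [NormedAddCommGroup F] [NormedSpace ℝ F]
    {G : ℝ → F} {G' : F} (hx : x ≠ 0) (hG : HasDerivAt G G' ‖x‖) :
    HasFDerivAt (fun y : 𝔼 d => G ‖y‖) ((‖x‖⁻¹ • innerSL ℝ x).smulRight G') x := by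
  have h1 : HasFDerivAt (fun y : 𝔼 d => ‖y‖) (‖x‖⁻¹ • innerSL ℝ x) x := by
    have h := (hasStrictFDerivAt_norm_sq x).hasFDerivAt.sqrt (by positivity)
    simp only [Real.sqrt_sq (norm_nonneg _)] at h
    convert! h using 1
    rw [← Nat.cast_smul_eq_nsmul ℝ, smul_smul]
    congr 1
    have := norm_ne_zero_iff.2 hx
    field_simp
    norm_num
  exact (hG.hasFDerivAt.comp x h1).congr_fderiv (by ext v; simp [mul_smul])

theorem linDeriv_rotGen_comp_norm {G : ℝ → ℂ} {G' : ℂ} (hx : x ≠ 0) (hG : HasDerivAt G G' ‖x‖)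
    (i j : Fin d) : linDeriv (rotGen i j) (fun y => G ‖y‖) x = 0 := by
  rw [linDeriv, (hG.hasFDerivAt_comp_norm hx).fderiv]
  simp [inner_rotGen_self]

theorem euler_comp_norm {G : ℝ → ℂ} {G' : ℂ} (hx : x ≠ 0) (hG : HasDerivAt G G' ‖x‖) :
    euler (fun y : 𝔼 d => G ‖y‖) x = ‖x‖ * G' := by
  rw [euler, linDeriv, (hG.hasFDerivAt_comp_norm hx).fderiv]
  have := norm_ne_zero_iff.2 hx
  simp [field]

theorem fderiv_norm_rpow_rotGen (p : ℝ) (hx : x ≠ 0) (i j : Fin d) :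
    fderiv ℝ (fun y : 𝔼 d => ‖y‖ ^ p) x (rotGen i j x) = 0 := by
  rw [((Real.hasDerivAt_rpow_const (p := p) (Or.inl (norm_ne_zero_iff.2 hx))).hasFDerivAt_comp_norm
    hx).fderiv]
  simp [inner_rotGen_self]

theorem fderiv_norm_rpow_self (p : ℝ) (hx : x ≠ 0) :
    fderiv ℝ (fun y : 𝔼 d => ‖y‖ ^ p) x x = p * ‖x‖ ^ p := by
  have h := norm_pos_iff.2 hx
  rw [((Real.hasDerivAt_rpow_const (p := p) (Or.inl h.ne')).hasFDerivAt_comp_norm hx).fderiv]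
  simp
  rw [Real.rpow_sub_one h.ne']
  field_simp

end Pointwise

/-! ### Dilations and rotations on the weighted space -/

section WeightedSpace

/-- The space of test functions supported away from the origin. -/
def testSubmodule (d : ℕ) : Submodule ℂ (𝔼 d → ℂ) where
  carrier := {f | IsTestAwayFromZero f}
  add_mem' := IsTestAwayFromZero.add
  zero_mem' := IsTestAwayFromZero.zero_fun
  smul_mem' c _ hf := hf.const_smul c

/-- The test functions, to be equipped with the scalar product of `L²(‖x‖ ^ p dx)`. -/
def TestSpace (d : ℕ) (_p : ℝ) : Type := testSubmodule d

variable {d : ℕ} {p : ℝ}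

namespace TestSpace

noncomputable instance : AddCommGroup (TestSpace d p) :=
  inferInstanceAs (AddCommGroup (testSubmodule d))

noncomputable instance : Module ℂ (TestSpace d p) :=
  inferInstanceAs (Module ℂ (testSubmodule d))

/-- The underlying function. -/
def toFun (f : TestSpace d p) : 𝔼 d → ℂ := Subtype.val (p := (· ∈ testSubmodule d)) f

instance : CoeFun (TestSpace d p) fun _ => 𝔼 d → ℂ := ⟨toFun⟩

/-- A test function as an element of the weighted space. -/
def of (p : ℝ) (f : 𝔼 d → ℂ) (hf : IsTestAwayFromZero f) : TestSpace d p := ⟨f, hf⟩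

theorem isTest (f : TestSpace d p) : IsTestAwayFromZero f := f.2

@[ext] theorem ext {f g : TestSpace d p} (h : ∀ x, f x = g x) : f = g := Subtype.ext (funext h)

@[simp] theorem of_apply (f : 𝔼 d → ℂ) (hf : IsTestAwayFromZero f) (x : 𝔼 d) : of p f hf x = f x :=
  rfl

@[simp] theorem add_apply (f g : TestSpace d p) (x : 𝔼 d) : (f + g) x = f x + g x := rfl

@[simp] theorem sub_apply (f g : TestSpace d p) (x : 𝔼 d) : (f - g) x = f x - g x := rfl

@[simp] theorem smul_apply (c : ℂ) (f : TestSpace d p) (x : 𝔼 d) : (c • f) x = c * f x := rfl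

@[simp] theorem zero_apply (x : 𝔼 d) : (0 : TestSpace d p) x = 0 := rfl

@[simp] theorem sum_apply {ι : Type*} (s : Finset ι) (f : ι → TestSpace d p) (x : 𝔼 d) :
    (∑ i ∈ s, f i) x = ∑ i ∈ s, f i x := by
  classical
  induction s using Finset.induction_on with
  | empty => simp
  | insert i s hi ih => simp [Finset.sum_insert hi, ih]

theorem isTest_weighted (p : ℝ) {f : 𝔼 d → ℂ} (hf : IsTestAwayFromZero f) :
    IsTestAwayFromZero fun x => f x * ((‖x‖ ^ p : ℝ) : ℂ) := by
  have h := hf.mul_left (g := fun x => ((‖x‖ ^ p : ℝ) : ℂ))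
    (Complex.ofRealCLM.contDiff.comp_contDiffOn (contDiffOn_norm_rpow p))
  simpa only [mul_comm] using h

theorem isTest_inner (f g : TestSpace d p) :
    IsTestAwayFromZero fun x => (starRingEnd ℂ) (f x) * g x * ((‖x‖ ^ p : ℝ) : ℂ) :=
  isTest_weighted p (g.isTest.mul_left f.isTest.star_comp.smooth.contDiffOn)

/-- A semidefinite form suffices, since the abstract lemmas hold in seminormed spaces; definiteness
is never required. -/
noncomputable instance : PreInnerProductSpace.Core ℂ (TestSpace d p) where
  inner f g := ∫ x, (starRingEnd ℂ) (f x) * g x * ((‖x‖ ^ p : ℝ) : ℂ)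
  conj_inner_symm f g := by
    rw [← integral_conj]
    refine integral_congr_ae (.of_forall fun x => ?_)
    simp only [map_mul, Complex.conj_conj, Complex.conj_ofReal]
    ring
  re_inner_nonneg f := by
    have h : ∀ x : 𝔼 d, (starRingEnd ℂ) (f x) * f x * ((‖x‖ ^ p : ℝ) : ℂ) =
        ((‖f x‖ ^ 2 * ‖x‖ ^ p : ℝ) : ℂ) := by
      intro x
      rw [Complex.conj_mul']
      push_cast
      ring
    simp_rw [h]
    rw [integral_complex_ofReal]
    exact integral_nonneg fun x => by positivity
  add_left f g h := by
    rw [← integral_add (isTest_inner f h).integrable (isTest_inner g h).integrable]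
    refine integral_congr_ae (.of_forall fun x => ?_)
    simp
    ring
  smul_left f g c := by
    rw [← integral_const_mul]
    refine integral_congr_ae (.of_forall fun x => ?_)
    simp
    ring

noncomputable instance : SeminormedAddCommGroup (TestSpace d p) :=
  InnerProductSpace.Core.toSeminormedAddCommGroup (𝕜 := ℂ)

noncomputable instance : InnerProductSpace ℂ (TestSpace d p) := InnerProductSpace.ofCore _

theorem inner_def (f g : TestSpace d p) :
    inner ℂ f g = ∫ x, (starRingEnd ℂ) (f x) * g x * ((‖x‖ ^ p : ℝ) : ℂ) := rfl

theorem norm_sq_eq (f : TestSpace d p) : ‖f‖ ^ 2 = ∫ x, ‖f x‖ ^ 2 * ‖x‖ ^ p := by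
  have h : ∀ x : 𝔼 d, (starRingEnd ℂ) (f x) * f x * ((‖x‖ ^ p : ℝ) : ℂ) =
      ((‖f x‖ ^ 2 * ‖x‖ ^ p : ℝ) : ℂ) := by
    intro x
    rw [Complex.conj_mul']
    push_cast
    ring
  have h2 : (‖f‖ ^ 2 : ℝ) = (inner ℂ f f : ℂ).re := (inner_self_eq_norm_sq (𝕜 := ℂ) f).symm
  rw [h2, inner_def]
  simp_rw [h]
  rw [integral_complex_ofReal]
  rfl

theorem integrable_norm_sq (f : TestSpace d p) : Integrable fun x => ‖f x‖ ^ 2 * ‖x‖ ^ p := by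
  refine (isTest_inner f f).integrable.norm.congr (.of_forall fun x => ?_)
  simp [sq, abs_of_nonneg (Real.rpow_nonneg (norm_nonneg x) p)]

/-- Differentiation along a linear vector field. -/
noncomputable def D (A : 𝔼 d →L[ℝ] 𝔼 d) : TestSpace d p →ₗ[ℂ] TestSpace d p where
  toFun f := of p (linDeriv A f) (f.isTest.linDeriv A)
  map_add' f g := by
    ext x
    have h : fderiv ℝ (fun x => f x + g x) x = fderiv ℝ f x + fderiv ℝ g x :=
      fderiv_fun_add (f.isTest.differentiable x) (g.isTest.differentiable x)
    exact congrArg (fun ℓ : 𝔼 d →L[ℝ] ℂ => ℓ (A x)) h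
  map_smul' c f := by
    ext x
    have h : fderiv ℝ (fun x => c * f x) x = c • fderiv ℝ f x :=
      fderiv_const_mul (f.isTest.differentiable x) c
    exact congrArg (fun ℓ : 𝔼 d →L[ℝ] ℂ => ℓ (A x)) h

theorem D_apply (A : 𝔼 d →L[ℝ] 𝔼 d) (f : TestSpace d p) (x : 𝔼 d) : D A f x = linDeriv A f x := rfl

theorem linDeriv_conj (A : 𝔼 d →L[ℝ] 𝔼 d) (f : TestSpace d p) (x : 𝔼 d) :
    linDeriv A (fun x => (starRingEnd ℂ) (f x)) x = (starRingEnd ℂ) (linDeriv A f x) := by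
  have h : HasFDerivAt (fun x => (starRingEnd ℂ) (f x))
      ((Complex.conjCLE : ℂ →L[ℝ] ℂ).comp (fderiv ℝ f x)) x :=
    Complex.conjCLE.hasFDerivAt.comp x (f.isTest.differentiable x).hasFDerivAt
  rw [linDeriv, h.fderiv]
  rfl

/-- Covers the two fields that matter: rotations preserve the weight (c = 0), and dilations scale it
(c = p). -/
theorem inner_D_add (A : 𝔼 d →L[ℝ] 𝔼 d) {c : ℝ}
    (hc : ∀ x : 𝔼 d, x ≠ 0 → fderiv ℝ (fun y : 𝔼 d => ‖y‖ ^ p) x (A x) = c * ‖x‖ ^ p)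
    (f g : TestSpace d p) :
    inner ℂ (D A f) g + inner ℂ f (D A g) = -((c + divergence A : ℝ) : ℂ) * inner ℂ f g := by
  have h := f.isTest.star_comp.integral_linDeriv_mul g.isTest A (contDiffOn_norm_rpow p) hc
  simp_rw [linDeriv_conj] at h
  exact h

theorem inner_D_rotGen (i j : Fin d) (f g : TestSpace d p) :
    inner ℂ (D (rotGen i j) f) g = - inner ℂ f (D (rotGen i j) g) := by
  have h := inner_D_add (rotGen i j) (c := 0) (fun x hx => by
    rw [fderiv_norm_rpow_rotGen p hx]; simp) f g
  rw [divergence_rotGen] at h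
  simp only [add_zero, Complex.ofReal_zero, neg_zero, zero_mul] at h
  exact eq_neg_of_add_eq_zero_left h

/-- The generator of dilations, made antisymmetric. -/
noncomputable def T : TestSpace d p →ₗ[ℂ] TestSpace d p :=
  D (ContinuousLinearMap.id ℝ (𝔼 d)) + (((p + d) / 2 : ℝ) : ℂ) • LinearMap.id

theorem T_apply (f : TestSpace d p) (x : 𝔼 d) :
    T f x = euler f x + (((p + d) / 2 : ℝ) : ℂ) * f x := rfl

theorem inner_T (f g : TestSpace d p) : inner ℂ (T f) g = - inner ℂ f (T g) := by
  have h := inner_D_add (ContinuousLinearMap.id ℝ (𝔼 d)) (c := p)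
    (fun x hx => fderiv_norm_rpow_self p hx) f g
  rw [divergence_id] at h
  simp only [T, LinearMap.add_apply, LinearMap.smul_apply, LinearMap.id_apply, inner_add_left,
    inner_add_right, inner_smul_left, inner_smul_right, Complex.conj_ofReal]
  push_cast at h ⊢
  linear_combination h

/-- The angular Laplacian on the space of test functions. -/
noncomputable def L : TestSpace d p →ₗ[ℂ] TestSpace d p :=
  (-(1 / 2) : ℂ) • ∑ i, ∑ j, D (rotGen i j) ∘ₗ D (rotGen i j)

theorem L_apply (f : TestSpace d p) (x : 𝔼 d) : L f x = angularLaplacian f x := by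
  simp only [L, LinearMap.smul_apply, LinearMap.sum_apply, LinearMap.comp_apply, smul_apply,
    sum_apply]
  rfl

/-- Each generator is antisymmetric, so one of the two factors moves across. Symmetry and positivity
of `L` both come from this formula. -/
theorem inner_L (f g : TestSpace d p) :
    inner ℂ (L f) g = 1 / 2 * ∑ i, ∑ j, inner ℂ (D (rotGen i j) f) (D (rotGen i j) g) := by
  simp only [L, LinearMap.smul_apply, LinearMap.sum_apply, LinearMap.comp_apply, inner_smul_left,
    sum_inner, inner_D_rotGen _ _ (D _ f), Finset.sum_neg_distrib, map_neg, map_div₀, map_one,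
    map_ofNat]
  ring

theorem L_isSymmetric : (L : TestSpace d p →ₗ[ℂ] TestSpace d p).IsSymmetric := by
  intro f g
  rw [inner_L, ← inner_conj_symm, inner_L]
  simp only [map_mul, map_sum, inner_conj_symm, map_div₀, map_one, map_ofNat]

theorem re_inner_L (f : TestSpace d p) :
    (inner ℂ (L f) f : ℂ).re = 1 / 2 * ∑ i, ∑ j, ‖D (rotGen i j) f‖ ^ 2 := by
  have hself : ∀ u : TestSpace d p, (inner ℂ u u : ℂ) = ((‖u‖ ^ 2 : ℝ) : ℂ) := fun u => by
    rw [inner_self_eq_norm_sq_to_K]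
    simp
  rw [inner_L]
  simp_rw [hself]
  norm_cast
  rw [← Complex.ofReal_one, ← Complex.ofReal_ofNat, ← Complex.ofReal_div, Complex.re_ofReal_mul,
    Complex.ofReal_re]

theorem re_inner_L_nonneg (f : TestSpace d p) : 0 ≤ (inner ℂ (L f) f : ℂ).re := by
  rw [re_inner_L]
  positivity

theorem contDiffAt (f : TestSpace d p) (x : 𝔼 d) : ContDiffAt ℝ 2 f x :=
  f.isTest.smooth.contDiffAt.of_le (by norm_cast)

theorem T_L (f : TestSpace d p) : T (L f) = L (T f) := by
  have h : ∀ (i j : Fin d) (u : TestSpace d p), T (D (rotGen i j) u) = D (rotGen i j) (T u) := by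
    intro i j u
    simp only [T, LinearMap.add_apply, LinearMap.smul_apply, LinearMap.id_apply, map_add, map_smul]
    congr 1
    ext x
    exact linDeriv_comm (fun y => rfl) (u.contDiffAt x)
  simp only [L, LinearMap.smul_apply, LinearMap.sum_apply, LinearMap.comp_apply, map_smul, map_sum,
    h]

/-- Radial factors commute with the generators of rotations. -/
theorem linDeriv_rotGen_mul {G : ℝ → ℂ} (hG : ContDiffOn ℝ ∞ G (Set.Ioi 0)) {f : 𝔼 d → ℂ} {x : 𝔼 d}
    (hx : x ≠ 0) (hf : DifferentiableAt ℝ f x) (i j : Fin d) :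
    linDeriv (rotGen i j) (fun y => G ‖y‖ * f y) x = G ‖x‖ * linDeriv (rotGen i j) f x := by
  have hd : DifferentiableAt ℝ G ‖x‖ :=
    (hG.contDiffAt (Ioi_mem_nhds (norm_pos_iff.2 hx))).differentiableAt (by simp)
  have h0 := linDeriv_rotGen_comp_norm hx hd.hasDerivAt i j
  have h : HasFDerivAt (fun y => G ‖y‖ * f y) _ x :=
    (hd.hasDerivAt.hasFDerivAt_comp_norm hx).differentiableAt.hasFDerivAt.mul hf.hasFDerivAt
  rw [linDeriv, h.fderiv]
  rw [linDeriv] at h0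
  simp [h0, linDeriv]

theorem angularLaplacian_mul {G : ℝ → ℂ} (hG : ContDiffOn ℝ ∞ G (Set.Ioi 0)) {f : 𝔼 d → ℂ} {x : 𝔼 d}
    (hx : x ≠ 0) (hf : ContDiff ℝ ∞ f) :
    angularLaplacian (fun y => G ‖y‖ * f y) x = G ‖x‖ * angularLaplacian f x := by
  have h : ∀ i j, linDeriv (rotGen i j) (linDeriv (rotGen i j) fun y => G ‖y‖ * f y) x =
      G ‖x‖ * linDeriv (rotGen i j) (linDeriv (rotGen i j) f) x := by
    intro i j
    -- The first-order identity is needed as an equality of germs, since it gets differentiated once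
    -- more.
    have he : linDeriv (rotGen i j) (fun y => G ‖y‖ * f y) =ᶠ[nhds x]
        fun y => G ‖y‖ * linDeriv (rotGen i j) f y := by
      filter_upwards [isOpen_compl_singleton.mem_nhds hx] with y hy
      exact linDeriv_rotGen_mul hG hy (hf.differentiable (by simp) y) i j
    rw [linDeriv, he.fderiv_eq]
    refine linDeriv_rotGen_mul hG hx ?_ i j
    exact (((hf.fderiv_right (m := ∞) (by simp)).clm_apply
      (rotGen i j).contDiff).differentiable (by simp)) x
  simp_rw [angularLaplacian, h, ← Finset.mul_sum]
  ring

end TestSpace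

end WeightedSpace

/-! ### Smooth homogeneous functions -/

section Homogeneous

variable {d : ℕ} {p : ℝ} {n m : ℕ} {P Q : 𝔼 d → ℂ}

/-- Smooth functions on the whole space which are homogeneous of degree `n`. -/
structure IsSmoothHomogeneous (n : ℕ) (P : 𝔼 d → ℂ) : Prop where
  smooth : ContDiff ℝ ∞ P
  map_smul : ∀ (t : ℝ) (x : 𝔼 d), P (t • x) = (t : ℂ) ^ n * P x

namespace IsSmoothHomogeneous

theorem mul (hP : IsSmoothHomogeneous n P) (hQ : IsSmoothHomogeneous m Q) :
    IsSmoothHomogeneous (n + m) (fun x => P x * Q x) :=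
  ⟨hP.smooth.mul hQ.smooth, fun t x => by rw [hP.map_smul, hQ.map_smul]; ring⟩

theorem const (c : ℂ) : IsSmoothHomogeneous 0 (fun _ : 𝔼 d => c) :=
  ⟨contDiff_const, fun t x => by simp⟩

theorem star_comp (hP : IsSmoothHomogeneous n P) :
    IsSmoothHomogeneous n (fun x => (starRingEnd ℂ) (P x)) :=
  ⟨Complex.conjCLE.contDiff.comp hP.smooth, fun t x => by simp [hP.map_smul]⟩

theorem coord (i : Fin d) : IsSmoothHomogeneous 1 (fun x : 𝔼 d => (x i : ℂ)) :=
  ⟨Complex.ofRealCLM.contDiff.comp (EuclideanSpace.proj i : 𝔼 d →L[ℝ] ℝ).contDiff,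
    fun t x => by simp⟩

theorem sum {ι : Type*} (s : Finset ι) {P : ι → 𝔼 d → ℂ}
    (hP : ∀ i ∈ s, IsSmoothHomogeneous n (P i)) :
    IsSmoothHomogeneous n (fun x => ∑ i ∈ s, P i x) :=
  ⟨ContDiff.sum fun i hi => (hP i hi).smooth, fun t x => by
    rw [Finset.mul_sum]
    exact Finset.sum_congr rfl fun i hi => (hP i hi).map_smul t x⟩

theorem euler_eq (hP : IsSmoothHomogeneous n P) : euler P = fun x => (n : ℂ) * P x := by
  ext x
  have h1 : HasDerivAt (fun t : ℝ => t • x) x 1 := by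
    simpa using (hasDerivAt_id (1 : ℝ)).smul_const x
  have h2 : HasDerivAt (fun t : ℝ => P (t • x)) (fderiv ℝ P ((1 : ℝ) • x) x) 1 :=
    ((hP.smooth.differentiable (by simp)) _).hasFDerivAt.comp_hasDerivAt 1 h1
  simp_rw [hP.map_smul, one_smul] at h2
  have h3 : HasDerivAt (fun t : ℝ => (t : ℂ) ^ n * P x) ((n : ℂ) * P x) 1 := by
    simpa using ((((hasDerivAt_id (1 : ℝ)).ofReal_comp).pow n).mul_const (P x))
  exact h2.unique h3

/-- The chain rule applied to P(t x) = tⁿ P(x). The factor t stays on the left, so t = 0 needs no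
exception. -/
theorem fderiv_apply_smul (hP : IsSmoothHomogeneous n P) (t : ℝ) (x v : 𝔼 d) :
    (t : ℂ) * fderiv ℝ P (t • x) v = (t : ℂ) ^ n * fderiv ℝ P x v := by
  have hd := hP.smooth.differentiable (by simp)
  have h1 : HasFDerivAt (fun x => P (t • x))
      ((fderiv ℝ P (t • x)).comp (t • ContinuousLinearMap.id ℝ (𝔼 d))) x :=
    (hd _).hasFDerivAt.comp x ((hasFDerivAt_id x).const_smul t)
  have h2 : HasFDerivAt (fun x => P (t • x)) ((t : ℂ) ^ n • fderiv ℝ P x) x := by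
    simp_rw [hP.map_smul]
    exact (hd x).hasFDerivAt.const_mul _
  simpa using congrArg (fun ℓ : 𝔼 d →L[ℝ] ℂ => ℓ v) (h1.unique h2)

theorem fderiv_apply (hP : IsSmoothHomogeneous (n + 1) P) (v : 𝔼 d) :
    IsSmoothHomogeneous n (fun x => fderiv ℝ P x v) := by
  have hs : ContDiff ℝ ∞ fun x => fderiv ℝ P x v :=
    (hP.smooth.fderiv_right (m := ∞) (by simp)).clm_apply contDiff_const
  refine ⟨hs, fun t x => ?_⟩
  have hc1 : Continuous fun t : ℝ => fderiv ℝ P (t • x) v := hs.continuous.comp (by fun_prop)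
  have hc2 : Continuous fun t : ℝ => (t : ℂ) ^ n * fderiv ℝ P x v := by fun_prop
  -- A factor t can be cancelled only for t ≠ 0; the value t = 0 follows by continuity.
  refine congrFun (hc1.ext_on (dense_compl_singleton (0 : ℝ)) hc2 fun t ht => ?_) t
  have ht' : (t : ℂ) ≠ 0 := by exact_mod_cast ht
  refine mul_left_cancel₀ ht' ?_
  rw [hP.fderiv_apply_smul]
  ring

/-- Taking t = 0, where 0⁰ = 1, shows that `P` is constant. -/
theorem fderiv_eq_zero (hP : IsSmoothHomogeneous 0 P) (x : 𝔼 d) : fderiv ℝ P x = 0 := by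
  have h : P = fun _ => P 0 := by
    ext y
    simpa using (hP.map_smul 0 y).symm
  rw [h]
  simp

theorem laplacian_eq (hP : IsSmoothHomogeneous n P) (x : 𝔼 d) :
    Laplacian.laplacian P x = ∑ i, fderiv ℝ (fun y => fderiv ℝ P y (EuclideanSpace.single i 1)) x
      (EuclideanSpace.single i 1) := by
  rw [laplacian_eq_sum_fderiv]
  refine Finset.sum_congr rfl fun i _ => ?_
  have h : DifferentiableAt ℝ (fderiv ℝ P) x :=
    (hP.smooth.fderiv_right (m := ∞) (by simp)).differentiable (by simp) x
  rw [(h.hasFDerivAt.clm_apply (hasFDerivAt_const _ x)).fderiv]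
  simp

theorem laplacian (hP : IsSmoothHomogeneous (n + 2) P) :
    IsSmoothHomogeneous n (Laplacian.laplacian P) := by
  have h : Laplacian.laplacian P = fun x => ∑ i, fderiv ℝ (fun y => fderiv ℝ P y
      (EuclideanSpace.single i 1)) x (EuclideanSpace.single i 1) := funext hP.laplacian_eq
  rw [h]
  exact sum _ fun i _ => (hP.fderiv_apply _).fderiv_apply _

theorem laplacian_eq_zero (hP : IsSmoothHomogeneous n P) (hn : n < 2) (x : 𝔼 d) :
    Laplacian.laplacian P x = 0 := by
  rw [hP.laplacian_eq]
  refine Finset.sum_eq_zero fun i _ => ?_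
  interval_cases n
  · simp [hP.fderiv_eq_zero]
  · rw [(hP.fderiv_apply (EuclideanSpace.single i 1)).fderiv_eq_zero]
    simp

/-- Euler's identity turns the radial part of the polar form into n² + (d - 2)n. Thus `P` is an
eigenfunction up to a term involving a homogeneous function of degree n - 2. -/
theorem angularLaplacian_eq (hP : IsSmoothHomogeneous n P) (x : 𝔼 d) :
    angularLaplacian P x = (sphereEigenvalue d n : ℂ) * P x -
      ((‖x‖ ^ 2 : ℝ) : ℂ) * Laplacian.laplacian P x := by
  have h := norm_sq_mul_laplacian (hP.smooth.contDiffAt (x := x).of_le (by norm_cast))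
  have h2 : euler (euler P) x = (n : ℂ) * (n * P x) := by
    have h3 : HasFDerivAt (fun x => (n : ℂ) * P x) _ x :=
      ((hP.smooth.differentiable (by simp)) x).hasFDerivAt.const_mul (n : ℂ)
    rw [hP.euler_eq, euler, linDeriv, h3.fderiv]
    have := congrFun hP.euler_eq x
    rw [euler, linDeriv] at this
    simpa using Or.inl this
  rw [h2, hP.euler_eq] at h
  rw [h, sphereEigenvalue]
  push_cast
  ring

end IsSmoothHomogeneous

end Homogeneous

/-! ### Density of the eigenfunctions -/

section Density

variable {d : ℕ} {p : ℝ}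

theorem sphereEigenvalue_strictMono (hd : 2 ≤ d) : StrictMono (sphereEigenvalue d) := by
  refine strictMono_nat_of_lt_succ fun k => ?_
  have h : (2 : ℝ) ≤ d := by exact_mod_cast hd
  have hk : (0 : ℝ) ≤ k := k.cast_nonneg
  simp only [sphereEigenvalue]
  push_cast
  nlinarith

theorem isTest_radial_mul {G : ℝ → ℂ} (hG : ContDiffOn ℝ ∞ G (Set.Ioi 0)) {a b : ℝ} (ha : 0 < a)
    (hab : ∀ r, 0 ≤ r → G r ≠ 0 → a ≤ r ∧ r ≤ b) {P : 𝔼 d → ℂ} (hP : ContDiff ℝ ∞ P) :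
    IsTestAwayFromZero fun x => G ‖x‖ * P x := by
  refine IsTestAwayFromZero.of_contDiffOn (ContDiffOn.mul ?_ hP.contDiffOn) ha (b := b)
    fun x hx => hab _ (norm_nonneg x) (left_ne_zero_of_mul hx)
  exact hG.comp (fun x hx => (contDiffAt_norm ℝ hx).contDiffWithinAt)
    fun x hx => norm_pos_iff.2 hx

open TestSpace Polynomial in
-- The factor L - λ_n sends G P to -G r² ΔP, again radial times homogeneous, of degree n - 2. The
-- profile `G` must vary in the induction in order to absorb -r².
theorem prod_sub_eigenvalue_radial_mul {a b : ℝ} (ha : 0 < a) (n : ℕ) {G : ℝ → ℂ}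
    (hG : ContDiffOn ℝ ∞ G (Set.Ioi 0)) (hab : ∀ r, 0 ≤ r → G r ≠ 0 → a ≤ r ∧ r ≤ b) {P : 𝔼 d → ℂ}
    (hP : IsSmoothHomogeneous n P) :
    aeval (TestSpace.L : Module.End ℂ (TestSpace d p))
      (∏ j ∈ Finset.range (n + 1), (X - C (sphereEigenvalue d j : ℂ)))
      (of p _ (isTest_radial_mul hG ha hab hP.smooth)) = 0 := by
  induction n using Nat.strong_induction_on generalizing G P with
  | _ n ih =>
    set F := of p _ (isTest_radial_mul hG ha hab hP.smooth) with hF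
    have hLF : ∀ x ≠ 0, TestSpace.L F x - (sphereEigenvalue d n : ℂ) * F x =
        -(G ‖x‖ * ((‖x‖ ^ 2 : ℝ) : ℂ)) * Laplacian.laplacian P x := by
      intro x hx
      rw [L_apply]
      have : angularLaplacian F x = G ‖x‖ * angularLaplacian P x :=
        angularLaplacian_mul hG hx hP.smooth
      rw [this, hP.angularLaplacian_eq]
      simp only [hF, of_apply]
      ring
    have h0 : ∀ u : TestSpace d p, u 0 = 0 := fun u => u.isTest.eq_zero
    rw [Finset.prod_range_succ, map_mul, Module.End.mul_apply]
    have hfac : aeval (TestSpace.L : Module.End ℂ (TestSpace d p))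
        (X - C (sphereEigenvalue d n : ℂ)) F = TestSpace.L F - (sphereEigenvalue d n : ℂ) • F := by
      simp
    rw [hfac]
    by_cases hn : n < 2
    · have : TestSpace.L F - (sphereEigenvalue d n : ℂ) • F = 0 := by
        ext x
        by_cases hx : x = 0
        · rw [hx, h0, zero_apply]
        · rw [sub_apply, smul_apply, hLF x hx, hP.laplacian_eq_zero hn]
          simp
      rw [this, map_zero]
    · obtain ⟨m, rfl⟩ : ∃ m, n = m + 2 := ⟨n - 2, by omega⟩
      have hG' : ContDiffOn ℝ ∞ (fun r => -(G r * ((r ^ 2 : ℝ) : ℂ))) (Set.Ioi 0) :=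
        (hG.mul (Complex.ofRealCLM.contDiff.comp (contDiff_id.pow 2)).contDiffOn).neg
      have hab' : ∀ r, 0 ≤ r → -(G r * ((r ^ 2 : ℝ) : ℂ)) ≠ 0 → a ≤ r ∧ r ≤ b := fun r hr0 hr =>
        hab r hr0 fun h => hr (by simp [h])
      have hk := ih m (by omega) hG' hab' hP.laplacian
      have : TestSpace.L F - (sphereEigenvalue d (m + 2) : ℂ) • F =
          of p _ (isTest_radial_mul hG' ha hab' hP.laplacian.smooth) := by
        ext x
        by_cases hx : x = 0
        · rw [hx, h0, h0]
        · rw [sub_apply, smul_apply, hLF x hx, of_apply]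
      -- The induction descends by two degrees, so the factor for `m + 1` is superfluous; commuting
      -- it to the outside leaves it acting on zero.
      rw [this, Finset.prod_range_succ, mul_comm, map_mul, Module.End.mul_apply, hk, map_zero]

open TestSpace in
theorem radial_mul_mem_iSup_eigenspace (hd : 2 ≤ d) {a b : ℝ} (ha : 0 < a) {n : ℕ} {G : ℝ → ℂ}
    (hG : ContDiffOn ℝ ∞ G (Set.Ioi 0)) (hab : ∀ r, 0 ≤ r → G r ≠ 0 → a ≤ r ∧ r ≤ b) {P : 𝔼 d → ℂ}
    (hP : IsSmoothHomogeneous n P) :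
    of p _ (isTest_radial_mul hG ha hab hP.smooth) ∈
      ⨆ j, Module.End.eigenspace (TestSpace.L : Module.End ℂ (TestSpace d p))
        (sphereEigenvalue d j : ℂ) :=
  mem_iSup_eigenspace_of_prod_eq_zero _ (lam := fun j => (sphereEigenvalue d j : ℂ))
    (fun _ _ h => (sphereEigenvalue_strictMono hd).injective (Complex.ofReal_injective h)) (n + 1)
    (prod_sub_eigenvalue_radial_mul ha n hG hab hP)

/-- Functions on `K` which are restrictions of smooth homogeneous functions. -/
def homogeneousSubmonoid (K : Set (𝔼 d)) : Submonoid C(K, ℂ) where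
  carrier := {q | ∃ (n : ℕ) (P : 𝔼 d → ℂ), IsSmoothHomogeneous n P ∧ ∀ x : K, q x = P x}
  one_mem' := ⟨0, _, IsSmoothHomogeneous.const 1, fun _ => rfl⟩
  mul_mem' := by
    rintro q r ⟨n, P, hP, hq⟩ ⟨m, Q, hQ, hr⟩
    exact ⟨n + m, _, hP.mul hQ, fun x => by simp [hq, hr]⟩

/-- The algebra spanned by the smooth homogeneous functions. -/
noncomputable def homogeneousAlgebra (K : Set (𝔼 d)) : StarSubalgebra ℂ C(K, ℂ) where
  toSubalgebra := Algebra.adjoin ℂ (homogeneousSubmonoid K : Set C(K, ℂ))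
  star_mem' := by
    intro q hq
    induction hq using Algebra.adjoin_induction with
    | mem q hq =>
      obtain ⟨n, P, hP, hq⟩ := hq
      exact Algebra.subset_adjoin ⟨n, _, hP.star_comp, fun x => by simp [hq]⟩
    | algebraMap c =>
      refine Algebra.subset_adjoin ⟨0, _, IsSmoothHomogeneous.const (star c), fun x => rfl⟩
    | add q r _ _ hq hr => rw [star_add]; exact Subalgebra.add_mem _ hq hr
    | mul q r _ _ hq hr => rw [star_mul]; exact Subalgebra.mul_mem _ hr hq

/-- Stone-Weierstrass: the coordinates are homogeneous and separate points. -/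
theorem homogeneousAlgebra_dense (K : Set (𝔼 d)) [CompactSpace K] :
    (homogeneousAlgebra K).topologicalClosure = ⊤ := by
  refine ContinuousMap.starSubalgebra_topologicalClosure_eq_top_of_separatesPoints _ ?_
  intro x y hxy
  obtain ⟨i, hi⟩ : ∃ i, (x : 𝔼 d) i ≠ (y : 𝔼 d) i := by
    by_contra! h
    exact hxy (Subtype.ext (PiLp.ext h))
  refine ⟨_, ⟨⟨fun z : K => ((z : 𝔼 d) i : ℂ), by fun_prop⟩,
    Algebra.subset_adjoin ⟨1, _, IsSmoothHomogeneous.coord i, fun _ => rfl⟩, rfl⟩, ?_⟩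
  simpa using hi

open TestSpace in
/-- The eigenfunctions of the angular Laplacian span a dense subspace. -/
theorem topologicalClosure_iSup_eigenspace_L (hd : 2 ≤ d) :
    (⨆ j, Module.End.eigenspace (TestSpace.L : Module.End ℂ (TestSpace d p))
      (sphereEigenvalue d j : ℂ)).topologicalClosure = ⊤ := by
  rw [eq_top_iff]
  intro f _
  refine Metric.mem_closure_iff.2 fun ε hε => ?_
  obtain ⟨a, b₀, ha, hab₀⟩ := f.isTest.exists_annulus
  set b := max b₀ (a + 1)
  have hlt : a < b := lt_of_lt_of_le (by linarith) (le_max_right _ _)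
  have hab : ∀ x ∈ tsupport f, a ≤ ‖x‖ ∧ ‖x‖ ≤ b := fun x hx =>
    ⟨(hab₀ x hx).1, (hab₀ x hx).2.trans (le_max_left _ _)⟩
  -- A radial cutoff, equal to 1 on [a, b] and zero outside [a/2, b + a/2]. It fixes `f` and turns
  -- the approximants into test functions.
  let χ : ContDiffBump ((a + b) / 2) :=
    ⟨(b - a) / 2, (b - a) / 2 + a / 2, by linarith, by linarith⟩
  let G : ℝ → ℂ := fun r => (χ r : ℂ)
  have hG : ContDiff ℝ ∞ G := Complex.ofRealCLM.contDiff.comp χ.contDiff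
  have hGs : ∀ r, G r ≠ 0 → a / 2 ≤ r ∧ r ≤ b + a / 2 := by
    intro r hr
    have : r ∈ Function.support χ := fun h => hr (by simp [G, h])
    rw [χ.support_eq, Metric.mem_ball, Real.dist_eq, abs_lt] at this
    simp only [χ] at this
    constructor <;> linarith [this.1, this.2]
  have hG1 : ∀ r, a ≤ r → r ≤ b → G r = 1 := by
    intro r h1 h2
    have : r ∈ Metric.closedBall ((a + b) / 2) χ.rIn := by
      rw [Metric.mem_closedBall, Real.dist_eq, abs_le]
      constructor <;> simp only [χ] <;> linarith
    simp [G, χ.one_of_mem_closedBall this]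
  have hGle : ∀ r, ‖G r‖ ≤ 1 := by
    intro r
    simpa [G, abs_of_nonneg χ.nonneg] using χ.le_one
  set K : Set (𝔼 d) := {x | a / 2 ≤ ‖x‖ ∧ ‖x‖ ≤ b + a / 2} with hKdef
  have hKc : IsCompact K := by
    refine IsCompact.of_isClosed_subset (isCompact_closedBall (0 : 𝔼 d) (b + a / 2)) ?_
      fun x hx => by simpa using hx.2
    exact (isClosed_le continuous_const continuous_norm).inter
      (isClosed_le continuous_norm continuous_const)
  have : CompactSpace K := isCompact_iff_compactSpace.1 hKc
  have hM : IntegrableOn (fun x : 𝔼 d => ‖x‖ ^ p) K := by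
    refine ((contDiffOn_norm_rpow p).continuousOn.mono fun x hx h => ?_).integrableOn_compact hKc
    rw [Set.mem_singleton_iff] at h
    have := hx.1
    rw [h, norm_zero] at this
    linarith
  set M := ∫ x in K, ‖x‖ ^ p
  have hM0 : 0 ≤ M := integral_nonneg fun x => by positivity
  -- A uniform error δ on `K` costs at most δ²M in squared norm; the added 1 makes this strictly
  -- less than ε² and avoids dividing by zero.
  set δ := ε / Real.sqrt (M + 1) with hδ
  have hs : 0 < Real.sqrt (M + 1) := Real.sqrt_pos.2 (by linarith)
  have hδ0 : 0 < δ := div_pos hε hs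
  let φ : C(K, ℂ) := ⟨fun x => f x, by
    have := f.isTest.continuous
    fun_prop⟩
  have hφ : φ ∈ (homogeneousAlgebra K).topologicalClosure := by
    rw [homogeneousAlgebra_dense]
    trivial
  obtain ⟨q, hq, hqφ⟩ := Metric.mem_closure_iff.1 hφ δ hδ0
  -- The generators are closed under products, so the algebra they generate is their linear span.
  have hq' : q ∈ Submodule.span ℂ (homogeneousSubmonoid K : Set C(K, ℂ)) := by
    have h : q ∈ Subalgebra.toSubmodule
      (Algebra.adjoin ℂ (homogeneousSubmonoid K : Set C(K, ℂ))) := hq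
    rwa [Algebra.adjoin_eq_span, Submonoid.closure_eq] at h
  obtain ⟨F, hF, hFK, hFK'⟩ : ∃ F ∈ ⨆ j, Module.End.eigenspace
      (TestSpace.L : Module.End ℂ (TestSpace d p)) (sphereEigenvalue d j : ℂ),
      (∀ x : K, F x = G ‖(x : 𝔼 d)‖ * q x) ∧ ∀ x ∉ K, F x = 0 := by
    clear hqφ hq
    induction hq' using Submodule.span_induction with
    | mem q hq =>
      obtain ⟨n, P, hP, hq⟩ := hq
      refine ⟨_, radial_mul_mem_iSup_eigenspace hd (half_pos ha) hG.contDiffOn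
        (fun r _ => hGs r) hP,
        fun x => ?_, fun x hx => ?_⟩
      · rw [of_apply, hq]
      · have : G ‖x‖ = 0 := by
          by_contra h
          exact hx (hGs _ h)
        rw [of_apply, this, zero_mul]
    | zero => exact ⟨0, zero_mem _, by simp, by simp⟩
    | add q r _ _ hq hr =>
      obtain ⟨F, h1, h2, h3⟩ := hq
      obtain ⟨F', h1', h2', h3'⟩ := hr
      exact ⟨F + F', add_mem h1 h1', fun x => by simp [h2, h2', mul_add],
        fun x hx => by simp [h3 x hx, h3' x hx]⟩
    | smul c q _ hq =>
      obtain ⟨F, h1, h2, h3⟩ := hq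
      exact ⟨c • F, Submodule.smul_mem _ c h1, fun x => by simp [h2]; ring,
        fun x hx => by simp [h3 x hx]⟩
  refine ⟨F, hF, ?_⟩
  have hpt : ∀ x, ‖(f - F) x‖ ^ 2 * ‖x‖ ^ p ≤ K.indicator (fun x => δ ^ 2 * ‖x‖ ^ p) x := by
    intro x
    by_cases hx : x ∈ K
    · rw [Set.indicator_of_mem hx]
      refine mul_le_mul_of_nonneg_right ?_ (by positivity)
      refine pow_le_pow_left₀ (norm_nonneg _) ?_ 2
      have h1 : f x = G ‖x‖ * f x := by
        by_cases hfx : x ∈ tsupport f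
        · rw [hG1 _ (hab x hfx).1 (hab x hfx).2, one_mul]
        · rw [image_eq_zero_of_notMem_tsupport hfx, mul_zero]
      have h2 : (f - F) x = G ‖x‖ * (φ ⟨x, hx⟩ - q ⟨x, hx⟩) := by
        rw [TestSpace.sub_apply, hFK ⟨x, hx⟩, mul_sub]
        exact congrArg (· - _) h1
      rw [h2, norm_mul]
      have h3 : ‖φ ⟨x, hx⟩ - q ⟨x, hx⟩‖ ≤ δ := by
        rw [← dist_eq_norm]
        exact (ContinuousMap.dist_apply_le_dist _).trans hqφ.le
      calc _ ≤ 1 * δ := mul_le_mul (hGle _) h3 (norm_nonneg _) zero_le_one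
        _ = δ := one_mul _
    · rw [Set.indicator_of_notMem hx, TestSpace.sub_apply, hFK' x hx]
      have : f x = 0 := by
        by_contra h
        have h' := hab x (subset_tsupport f h)
        exact hx ⟨by linarith [h'.1], by linarith [h'.2]⟩
      simp [this]
  have hK : MeasurableSet K := hKc.measurableSet
  have hle : ‖f - F‖ ^ 2 ≤ δ ^ 2 * M := by
    rw [norm_sq_eq]
    refine (integral_mono (integrable_norm_sq _) ?_ hpt).trans ?_
    · exact (integrable_indicator_iff hK).2 (hM.const_mul _)
    · rw [integral_indicator hK, integral_const_mul]
  have hlt' : δ ^ 2 * M < ε ^ 2 := by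
    have h : δ ^ 2 * (M + 1) = ε ^ 2 := by
      rw [hδ, div_pow, Real.sq_sqrt (by linarith)]
      field_simp
    nlinarith [sq_pos_of_pos hδ0]
  have := lt_of_pow_lt_pow_left₀ 2 hε.le (hle.trans_lt hlt')
  rwa [dist_eq_norm]

end Density

/-! ### The two integrals as quadratic forms, and the inequality -/

section HardyRellich

variable {d : ℕ} {p : ℝ}

namespace TestSpace

theorem eventuallyEq_zero (f : TestSpace d p) : f =ᶠ[nhds 0] fun _ => (0 : ℂ) :=
  notMem_tsupport_iff_eventuallyEq.1 f.isTest.zero_notMem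

theorem laplacian_zero (f : TestSpace d p) : Laplacian.laplacian f.toFun (0 : 𝔼 d) = 0 := by
  rw [laplacian_eq_sum_fderiv]
  refine Finset.sum_eq_zero fun i _ => ?_
  have h : fderiv ℝ f =ᶠ[nhds 0] fun _ => 0 := by
    filter_upwards [f.eventuallyEq_zero.fderiv (𝕜 := ℝ)] with x hx
    simp [hx]
  rw [h.fderiv_eq]
  simp

theorem gradSq_zero (f : TestSpace d p) : gradSq f (0 : 𝔼 d) = 0 := by
  simp [gradSq, (f.eventuallyEq_zero.fderiv_eq (𝕜 := ℝ))]

/-- The operator `L + (d - 4 - α) (d + α) / 4`. -/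
noncomputable def M (α : ℝ) : TestSpace d p →ₗ[ℂ] TestSpace d p :=
  L + ((((d : ℝ) - 4 - α) / 2 * (((d : ℝ) + α) / 2) : ℝ) : ℂ) • LinearMap.id

theorem M_apply (α : ℝ) (f : TestSpace d p) :
    M α f = L f + ((((d : ℝ) - 4 - α) / 2 * (((d : ℝ) + α) / 2) : ℝ) : ℂ) • f := rfl

theorem M_isSymmetric (α : ℝ) : (M α : TestSpace d p →ₗ[ℂ] TestSpace d p).IsSymmetric := by
  intro f g
  rw [M_apply, M_apply, inner_add_left, inner_add_right, inner_smul_left, inner_smul_right,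
    Complex.conj_ofReal, L_isSymmetric]

theorem T_M (α : ℝ) (f : TestSpace d p) : T (M α f) = M α (T f) := by
  rw [M_apply, M_apply, map_add, map_smul, T_L]

/-- Substitute x·∇ = T - (d - 4 - α)/2 in the polar form of |x|²Δ. The factor |x|², squared,
accounts for the exponent -4 - α. -/
theorem norm_sq_mul_rpow_rellich (α : ℝ) (f : TestSpace d (-4 - α)) (x : 𝔼 d) :
    rellichIntegrand α f x =
      ‖(T (T f) + ((α + 2 : ℝ) : ℂ) • T f - M α f) x‖ ^ 2 * ‖x‖ ^ (-4 - α) := by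
  by_cases hx : x = 0
  · subst hx
    rw [(T (T f) + ((α + 2 : ℝ) : ℂ) • T f - M α f).isTest.eq_zero, rellichIntegrand,
      laplacian_zero]
    simp
  have hx' := norm_pos_iff.2 hx
  have hTT : euler (T f) x = euler (euler f) x + ((((-4 - α) + d) / 2 : ℝ) : ℂ) * euler f x := by
    have h : D (ContinuousLinearMap.id ℝ (𝔼 d)) (T f) =
        D (ContinuousLinearMap.id ℝ (𝔼 d)) (D (ContinuousLinearMap.id ℝ (𝔼 d)) f) +
          ((((-4 - α) + d) / 2 : ℝ) : ℂ) • D (ContinuousLinearMap.id ℝ (𝔼 d)) f := by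
      simp [T]
    exact congrArg (fun u : TestSpace d (-4 - α) => u x) h
  have h : (T (T f) + ((α + 2 : ℝ) : ℂ) • T f - M α f) x =
      ((‖x‖ ^ 2 : ℝ) : ℂ) * Laplacian.laplacian f.toFun x := by
    rw [norm_sq_mul_laplacian (f.contDiffAt x), M_apply, TestSpace.sub_apply, add_apply, add_apply,
      TestSpace.smul_apply, TestSpace.smul_apply, L_apply, T_apply, T_apply, hTT]
    push_cast
    ring
  rw [h, norm_mul, Complex.norm_real, Real.norm_of_nonneg (by positivity), rellichIntegrand,
    sub_eq_add_neg, Real.rpow_add hx', Real.rpow_neg hx'.le, Real.rpow_neg hx'.le]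
  norm_num
  field_simp

theorem norm_sq_mul_rpow_hardy (α : ℝ) (f : TestSpace d (-4 - α)) (x : 𝔼 d) :
    hardyIntegrand α f x =
      ‖D (ContinuousLinearMap.id ℝ (𝔼 d)) f x‖ ^ 2 * ‖x‖ ^ (-4 - α) +
        1 / 2 * ∑ i, ∑ j, ‖D (rotGen i j) f x‖ ^ 2 * ‖x‖ ^ (-4 - α) := by
  by_cases hx : x = 0
  · subst hx
    simp [hardyIntegrand, gradSq_zero, (D _ f).isTest.eq_zero]
  have hx' := norm_pos_iff.2 hx
  have h := norm_sq_mul_gradSq f x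
  simp_rw [D_apply, ← Finset.sum_mul]
  rw [← mul_assoc, ← add_mul, ← h, hardyIntegrand, sub_eq_add_neg, Real.rpow_add hx',
    Real.rpow_add hx', Real.rpow_neg hx'.le, Real.rpow_neg hx'.le]
  norm_num
  field_simp

theorem integrable_rellich (α : ℝ) (f : TestSpace d (-4 - α)) :
    Integrable (rellichIntegrand α f) := by
  rw [funext (norm_sq_mul_rpow_rellich α f)]
  exact integrable_norm_sq _

theorem integrable_hardy (α : ℝ) (f : TestSpace d (-4 - α)) :
    Integrable (hardyIntegrand α f) := by
  rw [funext (norm_sq_mul_rpow_hardy α f)]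
  exact (integrable_norm_sq _).add ((integrable_finsetSum _ fun i _ =>
    integrable_finsetSum _ fun j _ => integrable_norm_sq _).const_mul _)

theorem integral_rellich (α : ℝ) (f : TestSpace d (-4 - α)) :
    ∫ x, rellichIntegrand α f x = ‖T (T f)‖ ^ 2 + 2 * (inner ℂ (M α (T f)) (T f)).re +
      (α + 2) ^ 2 * ‖T f‖ ^ 2 + ‖M α f‖ ^ 2 := by
  simp_rw [norm_sq_mul_rpow_rellich]
  rw [← norm_sq_eq, norm_sq_quadratic_antisymm inner_T (M_isSymmetric α) (T_M α)]

theorem integral_hardy (α : ℝ) (f : TestSpace d (-4 - α)) :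
    ∫ x, hardyIntegrand α f x = ‖T f‖ ^ 2 + (((d : ℝ) - 4 - α) / 2) ^ 2 * ‖f‖ ^ 2 +
      (inner ℂ (L f) f : ℂ).re := by
  simp_rw [norm_sq_mul_rpow_hardy]
  rw [integral_add (integrable_norm_sq _) ((integrable_finsetSum _ fun i _ =>
    integrable_finsetSum _ fun j _ => integrable_norm_sq _).const_mul _), integral_const_mul,
    integral_finsetSum _ fun i _ => integrable_finsetSum _ fun j _ => integrable_norm_sq _]
  simp_rw [integral_finsetSum _ fun (j : Fin d) _ => integrable_norm_sq _, ← norm_sq_eq]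
  rw [re_inner_L]
  congr 1
  have hE : D (ContinuousLinearMap.id ℝ (𝔼 d)) f =
      T f + ((-(((d : ℝ) - 4 - α) / 2) : ℝ) : ℂ) • f := by
    simp only [T, LinearMap.add_apply, LinearMap.smul_apply, LinearMap.id_apply, add_assoc,
      ← add_smul, ← Complex.ofReal_add]
    rw [show (-4 - α + (d : ℝ)) / 2 + -(((d : ℝ) - 4 - α) / 2) = 0 by ring]
    simp
  have h0 : (inner ℂ (T f) f : ℂ).re = 0 := by
    have h := congrArg Complex.re (inner_T f f)
    have h' : (inner ℂ (T f) f : ℂ).re = (inner ℂ f (T f) : ℂ).re := inner_re_symm (𝕜 := ℂ) _ _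
    rw [Complex.neg_re, ← h'] at h
    linarith
  rw [hE, norm_add_sq (𝕜 := ℂ), inner_smul_right, norm_smul, Complex.norm_real]
  simp only [RCLike.re_eq_complex_re, Complex.re_ofReal_mul, h0]
  rw [mul_pow, Real.norm_eq_abs, sq_abs]
  ring

/-- The weighted Hardy-Rellich inequality with any constant that is admissible for the individual
spherical harmonics. -/
theorem mul_integral_hardy_le (hd : 2 ≤ d) {α C : ℝ}
    (h1 : C ≤ (((d : ℝ) - 4 - α) / 2) ^ 2 + (((d : ℝ) + α) / 2) ^ 2)
    (h2 : ∀ k, C * (sphereEigenvalue d k + (((d : ℝ) - 4 - α) / 2) ^ 2) ≤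
      (sphereEigenvalue d k + ((d : ℝ) - 4 - α) / 2 * (((d : ℝ) + α) / 2)) ^ 2)
    (f : TestSpace d (-4 - α)) :
    C * ∫ x, hardyIntegrand α f x ≤ ∫ x, rellichIntegrand α f x := by
  rw [integral_hardy, integral_rellich]
  set σ := ((d : ℝ) - 4 - α) / 2 with hσ
  set τ := ((d : ℝ) + α) / 2 with hτ
  -- Consequently the coefficient 2στ + (α + 2)² of ‖T f‖² equals σ² + τ², the bound in `h1`.
  have hα : α + 2 = τ - σ := by rw [hσ, hτ]; ring
  have hM : ∀ u : TestSpace d (-4 - α), M α u = L u + ((σ * τ : ℝ) : ℂ) • u := fun u => M_apply α u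
  -- The quadratic is (λ + στ)² - C(λ + σ²), expanded in powers of λ.
  have k1 := L_isSymmetric.quadratic_nonneg_of_dense_eigenspaces
    (sphereEigenvalue_strictMono hd).injective (topologicalClosure_iSup_eigenspace_L hd)
    (b := 2 * (σ * τ) - C) (c := (σ * τ) ^ 2 - C * σ ^ 2) (fun j => by
      have := h2 j
      nlinarith) f
  have k2 : ‖M α f‖ ^ 2 = ‖L f‖ ^ 2 + 2 * (σ * τ) * (inner ℂ (L f) f).re +
      (σ * τ) ^ 2 * ‖f‖ ^ 2 := by
    rw [hM, norm_add_sq (𝕜 := ℂ), inner_smul_right, norm_smul, Complex.norm_real]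
    simp only [RCLike.re_eq_complex_re, Complex.re_ofReal_mul]
    rw [mul_pow, Real.norm_eq_abs, sq_abs]
    ring
  have k3 : (inner ℂ (M α (T f)) (T f)).re = (inner ℂ (L (T f)) (T f)).re +
      σ * τ * ‖T f‖ ^ 2 := by
    rw [hM, inner_add_left, inner_smul_left, Complex.conj_ofReal, Complex.add_re,
      Complex.re_ofReal_mul]
    congr 2
    exact inner_self_eq_norm_sq (𝕜 := ℂ) (T f)
  have k4 := re_inner_L_nonneg (T f)
  have k5 := mul_nonneg (sub_nonneg.2 h1) (sq_nonneg ‖T f‖)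
  have k6 := sq_nonneg ‖T (T f)‖
  rw [k2, k3, hα]
  nlinarith

end TestSpace

end HardyRellich

/-! ### Test functions concentrated on one harmonic -/

section Optimality

variable {d : ℕ} {p : ℝ}

/-- The linear function `x₀ + i x₁`. -/
noncomputable def holoCoord (hd : 2 ≤ d) : 𝔼 d →L[ℝ] ℂ :=
  Complex.ofRealCLM.comp (EuclideanSpace.proj (⟨0, by omega⟩ : Fin d)) +
    Complex.I • Complex.ofRealCLM.comp (EuclideanSpace.proj (⟨1, by omega⟩ : Fin d))

theorem holoCoord_apply (hd : 2 ≤ d) (x : 𝔼 d) :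
    holoCoord hd x = x ⟨0, by omega⟩ + Complex.I * x ⟨1, by omega⟩ := rfl

theorem holoCoord_pow_homogeneous (hd : 2 ≤ d) (k : ℕ) :
    IsSmoothHomogeneous k fun x : 𝔼 d => holoCoord hd x ^ k :=
  ⟨(holoCoord hd).contDiff.pow k, fun t x => by
    rw [map_smul, Complex.real_smul, mul_pow]⟩

/-- The squares of the linear form on the coordinate vectors sum to 1 + i² = 0. Truncated
subtraction does no harm, as the numerical prefactor vanishes for k < 2. -/
theorem laplacian_holoCoord_pow (hd : 2 ≤ d) (k : ℕ) (x : 𝔼 d) :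
    Laplacian.laplacian (fun x : 𝔼 d => holoCoord hd x ^ k) x = 0 := by
  have h1 : ∀ (k : ℕ) (y v : 𝔼 d), fderiv ℝ (fun x : 𝔼 d => holoCoord hd x ^ k) y v =
      k * holoCoord hd y ^ (k - 1) * holoCoord hd v := by
    intro k y v
    have h : HasFDerivAt (fun x : 𝔼 d => holoCoord hd x ^ k) _ y :=
      (holoCoord hd).hasFDerivAt.pow k
    rw [h.fderiv]
    simp
  have h2 : ∀ (v : 𝔼 d), fderiv ℝ (fun y => (k : ℂ) * holoCoord hd y ^ (k - 1) * holoCoord hd v) x v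
      = k * ((k - 1 : ℕ) * holoCoord hd x ^ (k - 1 - 1)) * holoCoord hd v ^ 2 := by
    intro v
    have hd' : DifferentiableAt ℝ (fun y : 𝔼 d => holoCoord hd y ^ (k - 1)) x :=
      ((holoCoord hd).differentiable.pow _) x
    have h : HasFDerivAt (fun y => (k : ℂ) * holoCoord hd y ^ (k - 1) * holoCoord hd v) _ x :=
      (hd'.hasFDerivAt.const_mul (k : ℂ)).mul_const (holoCoord hd v)
    rw [h.fderiv]
    simp [h1]
    ring
  rw [(holoCoord_pow_homogeneous hd k).laplacian_eq]
  simp_rw [h1, h2, ← Finset.mul_sum]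
  have h3 : ∑ i, holoCoord hd (EuclideanSpace.single i (1 : ℝ)) ^ 2 = 0 := by
    have h : ∀ i : Fin d, holoCoord hd (EuclideanSpace.single i (1 : ℝ)) ^ 2 =
        (if (⟨0, by omega⟩ : Fin d) = i then 1 else 0) -
          (if (⟨1, by omega⟩ : Fin d) = i then 1 else 0) := by
      intro i
      rw [holoCoord_apply]
      simp only [PiLp.single_apply]
      by_cases h0 : (⟨0, by omega⟩ : Fin d) = i
      · subst h0
        simp
      · by_cases h1 : (⟨1, by omega⟩ : Fin d) = i
        · subst h1
          simp
        · simp [h0, h1]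
    simp_rw [h, Finset.sum_sub_distrib]
    simp
  rw [h3, mul_zero]

/-- Integration in polar coordinates of the product of a radial and an angular function. -/
theorem integral_radial_mul_angular (hd : 2 ≤ d) (f : ℝ → ℝ) (h : 𝔼 d → ℝ) :
    ∫ x : 𝔼 d, h (‖x‖⁻¹ • x) * f ‖x‖ =
      (∫ θ, h θ ∂(volume : Measure (𝔼 d)).toSphere) *
        ∫ r in Set.Ioi (0 : ℝ), r ^ (d - 1) * f r := by
  have hnt : Nontrivial (𝔼 d) := by
    have : Nonempty (Fin d) := ⟨⟨0, by omega⟩⟩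
    infer_instance
  have hdim : Module.finrank ℝ (𝔼 d) = d := by simp
  set μ : Measure (𝔼 d) := volume
  calc
    ∫ x, h (‖x‖⁻¹ • x) * f ‖x‖ ∂μ
      = ∫ x : ({(0)}ᶜ : Set (𝔼 d)), h (‖x.1‖⁻¹ • x.1) * f ‖x.1‖ ∂(μ.comap (↑)) := by
      rw [integral_subtype_comap (measurableSet_singleton _).compl
        fun x : 𝔼 d => h (‖x‖⁻¹ • x) * f ‖x‖, restrict_compl_singleton]
    _ = ∫ x, h x.1 * f x.2 ∂μ.toSphere.prod (.volumeIoiPow (Module.finrank ℝ (𝔼 d) - 1)) := by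
      simpa using μ.measurePreserving_homeomorphUnitSphereProd.integral_comp
        (Homeomorph.measurableEmbedding _)
        fun x : Metric.sphere (0 : 𝔼 d) 1 × Set.Ioi (0 : ℝ) => h x.1 * f x.2
    _ = (∫ θ, h θ ∂μ.toSphere) *
        ∫ x : Set.Ioi (0 : ℝ), f x ∂.volumeIoiPow (Module.finrank ℝ (𝔼 d) - 1) :=
      integral_prod_mul (fun θ : Metric.sphere (0 : 𝔼 d) 1 => h θ)
        fun x : Set.Ioi (0 : ℝ) => f x
    _ = _ := by
      rw [hdim]
      congr 1
      simp only [Measure.volumeIoiPow, ENNReal.ofReal]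
      rw [integral_withDensity_eq_integral_smul,
        integral_subtype_comap measurableSet_Ioi fun a => Real.toNNReal (a ^ (d - 1)) • f a,
        setIntegral_congr_fun measurableSet_Ioi fun x hx => ?_]
      · rw [NNReal.smul_def, Real.coe_toNNReal _ (pow_nonneg hx.out.le _), smul_eq_mul]
      · exact (measurable_subtype_coe.pow_const _).real_toNNReal

/-- Substitution of a power of r: the measure dr/r is dt in t = log r, and powers of r dilate t. -/
theorem integral_inv_mul_comp_log_div (g : ℝ → ℝ) {n : ℝ} (hn : 0 < n) :
    ∫ r in Set.Ioi (0 : ℝ), r⁻¹ * g (Real.log r / n) =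
      n * ∫ r in Set.Ioi (0 : ℝ), r⁻¹ * g (Real.log r) := by
  rw [← integral_comp_rpow_Ioi_of_pos (g := fun r => r⁻¹ * g (Real.log r)) (inv_pos.2 hn),
    ← integral_const_mul]
  refine setIntegral_congr_fun measurableSet_Ioi fun r hr => ?_
  have hr' : (0 : ℝ) < r := hr
  simp only [smul_eq_mul]
  rw [Real.log_rpow hr', Real.rpow_sub_one hr'.ne', inv_mul_eq_div n]
  have := (Real.rpow_pos_of_pos hr' n⁻¹).ne'
  field_simp

/-- Radial profiles `r ^ q * η (log r / n)`. -/
noncomputable def logProfile (q n : ℝ) (η : ℝ → ℝ) (r : ℝ) : ℂ :=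
  ((r ^ q * η (Real.log r / n) : ℝ) : ℂ)

variable {η : ℝ → ℝ} {q n : ℝ}

theorem logProfile_contDiffOn (hη : ContDiff ℝ ∞ η) :
    ContDiffOn ℝ ∞ (logProfile q n η) (Set.Ioi 0) := by
  refine Complex.ofRealCLM.contDiff.comp_contDiffOn (ContDiffOn.mul ?_ ?_)
  · exact fun x hx => (contDiffAt_id.rpow_const_of_ne (ne_of_gt hx)).contDiffWithinAt
  · refine hη.comp_contDiffOn (ContDiffOn.div_const ?_ n)
    exact Real.contDiffOn_log.mono fun x hx => ne_of_gt hx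

theorem logProfile_support (hs : ∀ t, η t ≠ 0 → 1 ≤ t ∧ t ≤ 3) (hn : 0 < n) (r : ℝ) (hr : 0 ≤ r)
    (h : logProfile q n η r ≠ 0) : Real.exp n ≤ r ∧ r ≤ Real.exp (3 * n) := by
  have h1 : η (Real.log r / n) ≠ 0 := fun h0 => h (by simp [logProfile, h0])
  obtain ⟨h2, h3⟩ := hs _ h1
  rw [le_div_iff₀ hn, one_mul] at h2
  rw [div_le_iff₀ hn] at h3
  -- With the convention log 0 = 0, the radius 0 would correspond to t = 0, which lies outside [1,
  -- 3].
  have hr0 : 0 < r := hr.lt_of_ne fun h0 => by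
    rw [← h0, Real.log_zero] at h2
    linarith
  exact ⟨(Real.le_log_iff_exp_le hr0).1 h2, (Real.log_le_iff_le_exp hr0).1 h3⟩

theorem logProfile_hasDerivAt (hη : ContDiff ℝ ∞ η) {r : ℝ} (hr : 0 < r) :
    HasDerivAt (logProfile q n η)
      ((r : ℂ)⁻¹ * (q * logProfile q n η r + (n⁻¹ : ℝ) * logProfile q n (deriv η) r)) r := by
  have h1 : HasDerivAt (fun r : ℝ => r ^ q) (q * r ^ (q - 1)) r :=
    Real.hasDerivAt_rpow_const (Or.inl hr.ne')
  have h2 : HasDerivAt (fun r => η (Real.log r / n)) (deriv η (Real.log r / n) * (r⁻¹ / n)) r :=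
    ((hη.differentiable (by simp)) _).hasDerivAt.comp r ((Real.hasDerivAt_log hr.ne').div_const n)
  have h3 := (h1.mul h2).ofReal_comp
  refine h3.congr_deriv ?_
  rw [Real.rpow_sub_one hr.ne']
  simp only [logProfile]
  push_cast
  have : (r : ℂ) ≠ 0 := by exact_mod_cast hr.ne'
  field_simp

namespace TestSpace

/-- Test functions concentrated on the spherical harmonic `(x₀ + i x₁) ^ k`. -/
noncomputable def harmonicBump (p : ℝ) (hd : 2 ≤ d) (k : ℕ) (hη : ContDiff ℝ ∞ η)
    (hs : ∀ t, η t ≠ 0 → 1 ≤ t ∧ t ≤ 3) (hn : 0 < n) : TestSpace d p :=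
  -- The power k of r offsets the degree of the harmonic, and the remaining power -(p + d)/2 is
  -- exactly the one annihilated by `T`.
  of p (fun x => logProfile (-((p + d) / 2) - k) n η ‖x‖ * holoCoord hd x ^ k)
    (isTest_radial_mul (logProfile_contDiffOn hη) (Real.exp_pos n) (logProfile_support hs hn)
      (holoCoord_pow_homogeneous hd k).smooth)

theorem deriv_support (hs : ∀ t, η t ≠ 0 → 1 ≤ t ∧ t ≤ 3) (t : ℝ) (ht : deriv η t ≠ 0) :
    1 ≤ t ∧ t ≤ 3 := by
  have h : tsupport η ⊆ Set.Icc 1 3 := closure_minimal hs isClosed_Icc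
  exact h (support_deriv_subset ht)

variable (hd : 2 ≤ d) (k : ℕ) (hη : ContDiff ℝ ∞ η) (hs : ∀ t, η t ≠ 0 → 1 ≤ t ∧ t ≤ 3)
  (hn : 0 < n)

theorem L_harmonicBump :
    L (harmonicBump p hd k hη hs hn) =
      (sphereEigenvalue d k : ℂ) • harmonicBump p hd k hη hs hn := by
  ext x
  by_cases hx : x = 0
  · rw [hx, IsTestAwayFromZero.eq_zero (isTest _), IsTestAwayFromZero.eq_zero (isTest _)]
  rw [L_apply]
  refine (angularLaplacian_mul (logProfile_contDiffOn hη) hx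
    (holoCoord_pow_homogeneous hd k).smooth).trans ?_
  rw [(holoCoord_pow_homogeneous hd k).angularLaplacian_eq, laplacian_holoCoord_pow,
    TestSpace.smul_apply, harmonicBump, of_apply]
  ring

theorem T_harmonicBump (hη' : ContDiff ℝ ∞ (deriv η)) :
    T (harmonicBump p hd k hη hs hn) =
      ((n⁻¹ : ℝ) : ℂ) • harmonicBump p hd k hη' (deriv_support hs) hn := by
  ext x
  by_cases hx : x = 0
  · rw [hx, IsTestAwayFromZero.eq_zero (isTest _), IsTestAwayFromZero.eq_zero (isTest _)]
  have hx' := norm_pos_iff.2 hx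
  have hx'' : (‖x‖ : ℂ) ≠ 0 := by exact_mod_cast hx'.ne'
  rw [T_apply, TestSpace.smul_apply, harmonicBump, harmonicBump, of_apply, of_apply]
  set q := -((p + d) / 2) - k with hq
  have hG := logProfile_hasDerivAt (q := q) (n := n) hη hx'
  have h1 := euler_comp_norm hx hG
  have h2 := congrFun (holoCoord_pow_homogeneous hd k).euler_eq x
  have h : HasFDerivAt (fun y : 𝔼 d => logProfile q n η ‖y‖ * holoCoord hd y ^ k) _ x :=
    (hG.hasFDerivAt_comp_norm hx).differentiableAt.hasFDerivAt.mul
      ((holoCoord_pow_homogeneous hd k).smooth.differentiable (by simp) x).hasFDerivAt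
  rw [euler, linDeriv] at h1 h2
  have h3 : euler (fun y : 𝔼 d => logProfile q n η ‖y‖ * holoCoord hd y ^ k) x =
      logProfile q n η ‖x‖ * (k * holoCoord hd x ^ k) + holoCoord hd x ^ k *
        (q * logProfile q n η ‖x‖ + (n⁻¹ : ℝ) * logProfile q n (deriv η) ‖x‖) := by
    rw [euler, linDeriv, h.fderiv, _root_.add_apply, _root_.smul_apply, _root_.smul_apply, h1, h2]
    simp only [smul_eq_mul]
    field_simp
  change euler (fun y : 𝔼 d => logProfile q n η ‖y‖ * holoCoord hd y ^ k) x + _ = _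
  rw [h3, hq]
  push_cast
  ring

/-- In polar coordinates all powers of r combine to dr/r, so only the dilation of the logarithmic
variable depends on n. -/
theorem norm_sq_harmonicBump :
    ‖harmonicBump p hd k hη hs hn‖ ^ 2 = n * ‖harmonicBump p hd k hη hs one_pos‖ ^ 2 := by
  have key : ∀ {m : ℝ} (hm : 0 < m), ‖harmonicBump p hd k hη hs hm‖ ^ 2 =
      (∫ θ : Metric.sphere (0 : 𝔼 d) 1, ‖holoCoord hd θ ^ k‖ ^ 2 ∂(volume : Measure (𝔼 d)).toSphere) *
        ∫ r in Set.Ioi (0 : ℝ), r⁻¹ * (η (Real.log r / m)) ^ 2 := by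
    intro m hm
    have h := integral_radial_mul_angular hd
      (fun r => (r ^ (d - 1))⁻¹ * (r⁻¹ * (η (Real.log r / m)) ^ 2))
      (fun x : 𝔼 d => ‖holoCoord hd x ^ k‖ ^ 2)
    have h2 : ∫ r in Set.Ioi (0 : ℝ), r ^ (d - 1) *
        ((r ^ (d - 1))⁻¹ * (r⁻¹ * (η (Real.log r / m)) ^ 2)) =
        ∫ r in Set.Ioi (0 : ℝ), r⁻¹ * (η (Real.log r / m)) ^ 2 := by
      refine setIntegral_congr_fun measurableSet_Ioi fun r hr => ?_
      have hr' : (0 : ℝ) < r := hr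
      have := (pow_pos hr' (d - 1)).ne'
      field_simp
    rw [h2] at h
    rw [← h, norm_sq_eq]
    refine integral_congr_ae (.of_forall fun x => ?_)
    by_cases hx : x = 0
    · have h0 : η 0 = 0 := by
        by_contra h0
        linarith [(hs 0 h0).1]
      simp only [hx, (harmonicBump p hd k hη hs hm).isTest.eq_zero]
      simp [h0]
    have hx' := norm_pos_iff.2 hx
    have e1 : ‖x‖ ^ (-((p + d) / 2) - (k : ℝ)) = (‖x‖ ^ ((p + d) / 2))⁻¹ * (‖x‖ ^ k)⁻¹ := by
      rw [Real.rpow_sub hx', Real.rpow_neg hx'.le, Real.rpow_natCast]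
      rfl
    have e2 : ‖x‖ ^ p = (‖x‖ ^ ((p + d) / 2)) ^ 2 * (‖x‖ ^ (d - 1))⁻¹ * ‖x‖⁻¹ := by
      rw [mul_assoc, ← mul_inv, ← pow_succ, Nat.sub_add_cancel (by omega), ← Real.rpow_natCast,
        ← Real.rpow_natCast, ← Real.rpow_mul hx'.le, ← Real.rpow_neg hx'.le, ← Real.rpow_add hx']
      congr 1
      push_cast
      ring
    have e3 : ‖harmonicBump p hd k hη hs hm x‖ =
        ‖x‖ ^ (-((p + d) / 2) - (k : ℝ)) * |η (Real.log ‖x‖ / m)| * ‖holoCoord hd x‖ ^ k := by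
      rw [harmonicBump, of_apply, logProfile, norm_mul, Complex.norm_real, norm_mul, norm_pow,
        Real.norm_of_nonneg (Real.rpow_nonneg hx'.le _), Real.norm_eq_abs]
    have e4 : ‖holoCoord hd (‖x‖⁻¹ • x) ^ k‖ = (‖x‖ ^ k)⁻¹ * ‖holoCoord hd x‖ ^ k := by
      rw [map_smul, norm_pow, norm_smul, mul_pow, norm_inv, norm_norm, inv_pow]
    have e5 := (Real.rpow_pos_of_pos hx' ((p + d) / 2)).ne'
    simp only [e3, e4]
    rw [e1, e2, ← sq_abs (η _)]
    generalize ‖x‖ ^ ((p + d) / 2) = y at *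
    field_simp
  rw [key hn, key one_pos, integral_inv_mul_comp_log_div (fun t => η t ^ 2) hn]
  simp only [div_one]
  ring

theorem norm_sq_harmonicBump_pos {t : ℝ} (ht : η t ≠ 0) :
    0 < ‖harmonicBump p hd k hη hs one_pos‖ ^ 2 := by
  set f := harmonicBump p hd k hη hs one_pos with hf
  rw [norm_sq_eq]
  have heq : (fun x => ‖f x‖ ^ 2 * ‖x‖ ^ p) =
      fun x => ‖(starRingEnd ℂ) (f x) * f x * ((‖x‖ ^ p : ℝ) : ℂ)‖ := by
    ext x
    simp [sq, abs_of_nonneg (Real.rpow_nonneg (norm_nonneg x) p)]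
  let x : 𝔼 d := EuclideanSpace.single ⟨0, by omega⟩ (Real.exp t)
  have hx : ‖x‖ = Real.exp t := by simp [x]
  refine Continuous.integral_pos_of_hasCompactSupport_nonneg_nonzero (x := x) ?_ ?_ ?_ ?_
  · rw [heq]
    exact (isTest_inner f f).continuous.norm
  · rw [heq]
    exact (isTest_inner f f).compactSupport.norm
  · intro x
    positivity
  · have h1 : holoCoord hd x ≠ 0 := by
      rw [holoCoord_apply]
      simp [x]
    have h2 : f x ≠ 0 := by
      rw [hf, harmonicBump, of_apply, hx]
      refine mul_ne_zero ?_ (pow_ne_zero _ h1)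
      rw [logProfile, Real.log_exp, div_one]
      exact_mod_cast mul_ne_zero (Real.rpow_pos_of_pos (Real.exp_pos t) _).ne' ht
    rw [hx]
    have := norm_pos_iff.2 h2
    have := Real.rpow_pos_of_pos (Real.exp_pos t) p
    positivity

end TestSpace

end Optimality

/-! ### Arithmetic of the constant -/

section Constant

variable {d : ℕ} {α : ℝ}

theorem sphereEigenvalue_nonneg (hd : 2 ≤ d) (k : ℕ) : 0 ≤ sphereEigenvalue d k := by
  have h : (2 : ℝ) ≤ d := by exact_mod_cast hd
  have hk : (0 : ℝ) ≤ k := k.cast_nonneg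
  exact mul_nonneg hk (by linarith)

theorem le_sphereEigenvalue (hd : 2 ≤ d) (k : ℕ) : (k : ℝ) ≤ sphereEigenvalue d k := by
  have h : (2 : ℝ) ≤ d := by exact_mod_cast hd
  rcases Nat.eq_zero_or_pos k with rfl | hk
  · simp [sphereEigenvalue]
  · have hk : (1 : ℝ) ≤ k := by exact_mod_cast hk
    exact le_mul_of_one_le_right (by linarith) (by linarith)

theorem tendsto_hardyRellichQuotient (hd : 2 ≤ d) (hα : (d : ℝ) - α - 4 ≠ 0) :
    Filter.Tendsto (hardyRellichQuotient d α) Filter.atTop Filter.atTop := by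
  set a := (d : ℝ) - 4 - α with ha
  have ha0 : 0 < a ^ 2 := by
    have : a ≠ 0 := fun h => hα (by linarith)
    positivity
  set c := a * ((d : ℝ) + α) with hc
  -- With X = 4λ, write (X + c)² = (X + a²)² + 2(c - a²)(X + a²) + (c - a²)² and drop the last
  -- square; then use λ ≥ k.
  have hlow : ∀ k : ℕ, (k : ℝ) + (2 * c - a ^ 2) / 4 ≤ hardyRellichQuotient d α k := by
    intro k
    have h1 := le_sphereEigenvalue hd k
    have h0 : (0 : ℝ) ≤ k := k.cast_nonneg
    have hpos : 0 < 4 * sphereEigenvalue d k + a ^ 2 := by linarith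
    rw [hardyRellichQuotient, le_div_iff₀ (by linarith)]
    have h2 : ((k : ℝ) + (2 * c - a ^ 2) / 4) * (4 * (4 * sphereEigenvalue d k + a ^ 2)) ≤
        (sphereEigenvalue d k + (2 * c - a ^ 2) / 4) *
          (4 * (4 * sphereEigenvalue d k + a ^ 2)) :=
      mul_le_mul_of_nonneg_right (by linarith) (by linarith)
    nlinarith [sq_nonneg (c - a ^ 2)]
  exact Filter.tendsto_atTop_mono hlow
    (Filter.tendsto_atTop_add_const_right _ _ tendsto_natCast_atTop_atTop)

theorem hardyRellichConst_eq_iInf (hα : (d : ℝ) - α - 4 ≠ 0) :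
    hardyRellichConst d α = ⨅ k, hardyRellichQuotient d α k := if_pos hα

theorem isLeast_hardyRellichConst (hd : 2 ≤ d) (hα : (d : ℝ) - α - 4 ≠ 0) :
    IsLeast (Set.range (hardyRellichQuotient d α)) (hardyRellichConst d α) := by
  have ht := tendsto_hardyRellichQuotient hd hα
  rw [← Nat.cofinite_eq_atTop] at ht
  obtain ⟨k, hk⟩ := ht.exists_forall_le
  have hl : IsLeast (Set.range (hardyRellichQuotient d α)) (hardyRellichQuotient d α k) :=
    ⟨⟨k, rfl⟩, by rintro _ ⟨j, rfl⟩; exact hk j⟩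
  rw [hardyRellichConst_eq_iInf hα, iInf, hl.csInf_eq]
  exact hl

theorem hardyRellichQuotient_denom_pos (hd : 2 ≤ d) (hα : (d : ℝ) - α - 4 ≠ 0) (k : ℕ) :
    0 < sphereEigenvalue d k + (((d : ℝ) - 4 - α) / 2) ^ 2 := by
  have h1 := sphereEigenvalue_nonneg hd k
  have : (d : ℝ) - 4 - α ≠ 0 := fun h => hα (by linarith)
  positivity

theorem hardyRellichQuotient_eq (k : ℕ) :
    hardyRellichQuotient d α k =
      (sphereEigenvalue d k + ((d : ℝ) - 4 - α) / 2 * (((d : ℝ) + α) / 2)) ^ 2 /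
        (sphereEigenvalue d k + (((d : ℝ) - 4 - α) / 2) ^ 2) := by
  rw [hardyRellichQuotient, ← mul_div_mul_left _ (sphereEigenvalue d k + _) (by norm_num : (16 : ℝ) ≠ 0)]
  congr 1 <;> ring

/-- In the critical case σ = 0, degree 0 reads 0 ≤ 0 and the others reduce to C ≤ λ_k, whose least
instance is λ_1 = d - 1. -/
theorem hardyRellichConst_mul_le (hd : 2 ≤ d) (k : ℕ) :
    hardyRellichConst d α * (sphereEigenvalue d k + (((d : ℝ) - 4 - α) / 2) ^ 2) ≤
      (sphereEigenvalue d k + ((d : ℝ) - 4 - α) / 2 * (((d : ℝ) + α) / 2)) ^ 2 := by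
  by_cases hα : (d : ℝ) - α - 4 = 0
  · have h : (d : ℝ) - 4 - α = 0 := by linarith
    rw [h]
    rcases Nat.eq_zero_or_pos k with rfl | hk
    · simp [sphereEigenvalue]
    · have h1 : hardyRellichConst d α ≤ d - 1 := by
        rw [hardyRellichConst, if_neg (not_not.2 hα)]
        exact min_le_right _ _
      have h2 : (d : ℝ) - 1 ≤ sphereEigenvalue d k := by
        have := (sphereEigenvalue_strictMono hd).monotone hk
        refine le_trans (le_of_eq ?_) this
        simp [sphereEigenvalue]
        ring
      have h3 := mul_le_mul_of_nonneg_right (h1.trans h2) (sphereEigenvalue_nonneg hd k)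
      nlinarith
  · rw [← le_div_iff₀ (hardyRellichQuotient_denom_pos hd hα k), ← hardyRellichQuotient_eq]
    exact (isLeast_hardyRellichConst hd hα).2 ⟨k, rfl⟩

/-- Away from the critical case, degree 0 alone bounds the constant by τ²; in it, the right side is
exactly (d - 2)². -/
theorem hardyRellichConst_le_add (hd : 2 ≤ d) :
    hardyRellichConst d α ≤ (((d : ℝ) - 4 - α) / 2) ^ 2 + (((d : ℝ) + α) / 2) ^ 2 := by
  by_cases hα : (d : ℝ) - α - 4 = 0
  · have h1 : hardyRellichConst d α ≤ ((d : ℝ) - 2) ^ 2 := by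
      rw [hardyRellichConst, if_neg (not_not.2 hα)]
      exact min_le_left _ _
    refine h1.trans (le_of_eq ?_)
    rw [show α = d - 4 by linarith]
    ring
  · have h := hardyRellichConst_mul_le (α := α) hd 0
    have h2 := hardyRellichQuotient_denom_pos hd hα 0
    rw [← le_div_iff₀ h2] at h
    refine h.trans ?_
    rw [div_le_iff₀ h2]
    simp only [sphereEigenvalue, Nat.cast_zero, zero_mul, zero_add]
    nlinarith [sq_nonneg ((((d : ℝ) - 4 - α) / 2) ^ 2)]

theorem le_hardyRellichConst (hd : 2 ≤ d) {C : ℝ}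
    (h1 : ∀ k, C * (sphereEigenvalue d k + (((d : ℝ) - 4 - α) / 2) ^ 2) ≤
      (sphereEigenvalue d k + ((d : ℝ) - 4 - α) / 2 * (((d : ℝ) + α) / 2)) ^ 2)
    (h2 : (d : ℝ) - α - 4 = 0 → C ≤ ((d : ℝ) - 2) ^ 2) : C ≤ hardyRellichConst d α := by
  by_cases hα : (d : ℝ) - α - 4 = 0
  · rw [hardyRellichConst, if_neg (not_not.2 hα)]
    refine le_min (h2 hα) ?_
    have h := h1 1
    have hd' : (2 : ℝ) ≤ d := by exact_mod_cast hd
    rw [show (d : ℝ) - 4 - α = 0 by linarith] at h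
    simp only [sphereEigenvalue, Nat.cast_one] at h
    refine le_of_mul_le_mul_right (a := (d : ℝ) - 1) ?_ (by linarith)
    nlinarith
  · obtain ⟨k, hk⟩ := (isLeast_hardyRellichConst hd hα).1
    rw [← hk, hardyRellichQuotient_eq, le_div_iff₀ (hardyRellichQuotient_denom_pos hd hα k)]
    exact h1 k

theorem hardyRellichConst_eq_of_isLeast (hd : 2 ≤ d) (hα : (d : ℝ) - α - 4 ≠ 0) (k : ℕ)
    (h : ∀ j, hardyRellichQuotient d α k ≤ hardyRellichQuotient d α j) :
    hardyRellichConst d α = hardyRellichQuotient d α k :=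
  (isLeast_hardyRellichConst hd hα).unique ⟨⟨k, rfl⟩, by rintro _ ⟨j, rfl⟩; exact h j⟩

theorem hardyRellichConst_two : hardyRellichConst 2 0 = 0 := by
  have h1 : hardyRellichQuotient 2 0 1 = 0 := by
    norm_num [hardyRellichQuotient, sphereEigenvalue]
  rw [hardyRellichConst_eq_of_isLeast le_rfl (by norm_num) 1, h1]
  intro j
  rw [h1, hardyRellichQuotient]
  have := sphereEigenvalue_nonneg (d := 2) le_rfl j
  positivity

theorem hardyRellichConst_three : hardyRellichConst 3 0 = 25 / 36 := by
  have h1 : hardyRellichQuotient 3 0 1 = 25 / 36 := by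
    norm_num [hardyRellichQuotient, sphereEigenvalue]
  rw [hardyRellichConst_eq_of_isLeast (by norm_num) (by norm_num) 1, h1]
  intro j
  have h0 := sphereEigenvalue_nonneg (d := 3) (by norm_num) j
  rw [h1, hardyRellichQuotient, le_div_iff₀ (by positivity)]
  norm_num
  -- The inequality, quadratic in λ, fails just below λ = 2, so the gap between the first two
  -- eigenvalues is essential.
  have h : sphereEigenvalue 3 j = 0 ∨ 2 ≤ sphereEigenvalue 3 j := by
    rcases Nat.eq_zero_or_pos j with rfl | hj
    · left
      simp [sphereEigenvalue]
    · right
      have := (sphereEigenvalue_strictMono (d := 3) (by norm_num)).monotone hj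
      refine le_trans (le_of_eq ?_) this
      norm_num [sphereEigenvalue]
  rcases h with h | h
  · rw [h]
    norm_num
  · nlinarith

theorem hardyRellichConst_four : hardyRellichConst 4 0 = 3 := by
  rw [hardyRellichConst, if_neg (by norm_num)]
  norm_num

theorem hardyRellichConst_of_five_le (hd : 5 ≤ d) : hardyRellichConst d 0 = (d : ℝ) ^ 2 / 4 := by
  have hd' : (5 : ℝ) ≤ d := by exact_mod_cast hd
  have h4 : (d : ℝ) - 4 ≠ 0 := by linarith
  have h1 : hardyRellichQuotient d 0 0 = (d : ℝ) ^ 2 / 4 := by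
    simp [hardyRellichQuotient, sphereEigenvalue]
    field_simp
  rw [hardyRellichConst_eq_of_isLeast (by omega) (by simpa using h4) 0, h1]
  intro j
  have h0 := sphereEigenvalue_nonneg (d := d) (by omega) j
  have hp : 0 < ((d : ℝ) - 4) ^ 2 := by positivity
  rw [h1, hardyRellichQuotient, le_div_iff₀ (by simp only [sub_zero]; positivity)]
  simp only [sub_zero, add_zero]
  have h : sphereEigenvalue d j = 0 ∨ (d : ℝ) - 1 ≤ sphereEigenvalue d j := by
    rcases Nat.eq_zero_or_pos j with rfl | hj
    · left
      simp [sphereEigenvalue]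
    · right
      have := (sphereEigenvalue_strictMono (d := d) (by omega)).monotone hj
      refine le_trans (le_of_eq ?_) this
      simp [sphereEigenvalue]
      ring
  rcases h with h | h
  · rw [h]
    apply le_of_eq
    ring
  · have h2 : 0 ≤ 4 * sphereEigenvalue d j + (d : ℝ) ^ 2 - 8 * d := by nlinarith
    nlinarith [mul_nonneg h0 h2]

end Constant

/-! ### Optimality and conclusion -/

section Main

variable {d : ℕ}

/-- A smooth profile supported in `[1, 3]` which does not vanish identically. -/
theorem exists_profile : ∃ η : ℝ → ℝ, ContDiff ℝ ∞ η ∧ (∀ t, η t ≠ 0 → 1 ≤ t ∧ t ≤ 3) ∧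
    (∃ t, η t ≠ 0) ∧ ∃ t, deriv η t ≠ 0 := by
  let χ : ContDiffBump (2 : ℝ) := ⟨1 / 2, 1, by norm_num, by norm_num⟩
  have hs : ∀ t, χ t ≠ 0 → 1 ≤ t ∧ t ≤ 3 := by
    intro t ht
    have : t ∈ Function.support χ := ht
    rw [χ.support_eq, Metric.mem_ball, Real.dist_eq, abs_lt] at this
    simp only [χ] at this
    constructor <;> linarith [this.1, this.2]
  have h2 : χ 2 = 1 := χ.one_of_mem_closedBall (Metric.mem_closedBall_self (by norm_num [χ]))
  have h0 : χ 0 = 0 := by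
    by_contra h
    linarith [(hs 0 h).1]
  refine ⟨χ, χ.contDiff, hs, ⟨2, by simp [h2]⟩, ?_⟩
  by_contra! h
  have := is_const_of_deriv_eq_zero (χ.contDiff (n := 1) |>.differentiable (by simp)) h 2 0
  rw [h2, h0] at this
  exact one_ne_zero this

/-- The inequalities for the constant obtained by testing with `harmonicBump`. -/
theorem exists_tested_inequality (hd : 2 ≤ d) {α C : ℝ}
    (hC : ∀ ψ : 𝔼 d → ℂ, IsTestAwayFromZero ψ →
      C * ∫ x, hardyIntegrand α ψ x ≤ ∫ x, rellichIntegrand α ψ x) (k : ℕ) :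
    ∃ N₀ N₁ N₂ : ℝ, 0 < N₀ ∧ 0 < N₁ ∧ ∀ n : ℝ, 0 < n →
      C * ((n ^ 2)⁻¹ * N₁ + (sphereEigenvalue d k + (((d : ℝ) - 4 - α) / 2) ^ 2) * N₀) ≤
        ((n ^ 2)⁻¹) ^ 2 * N₂ + (2 * (sphereEigenvalue d k + ((d : ℝ) - 4 - α) / 2 *
          (((d : ℝ) + α) / 2)) + (α + 2) ^ 2) * ((n ^ 2)⁻¹ * N₁) +
        (sphereEigenvalue d k + ((d : ℝ) - 4 - α) / 2 * (((d : ℝ) + α) / 2)) ^ 2 * N₀ := by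
  obtain ⟨η, hη, hs, ⟨t₀, ht₀⟩, t₁, ht₁⟩ := exists_profile
  have hη1 : ContDiff ℝ ∞ (deriv η) := (contDiff_infty_iff_deriv.1 hη).2
  have hη2 : ContDiff ℝ ∞ (deriv (deriv η)) := (contDiff_infty_iff_deriv.1 hη1).2
  have hs1 := TestSpace.deriv_support hs
  have hs2 := TestSpace.deriv_support hs1
  refine ⟨_, _, ‖TestSpace.harmonicBump (-4 - α) hd k hη2 hs2 one_pos‖ ^ 2,
    TestSpace.norm_sq_harmonicBump_pos (p := -4 - α) hd k hη hs ht₀,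
    TestSpace.norm_sq_harmonicBump_pos (p := -4 - α) hd k hη1 hs1 ht₁, fun n hn => ?_⟩
  have h := hC _ (TestSpace.harmonicBump (-4 - α) hd k hη hs hn).isTest
  rw [TestSpace.integral_hardy, TestSpace.integral_rellich] at h
  have hM : ∀ f : TestSpace d (-4 - α), TestSpace.L f = (sphereEigenvalue d k : ℂ) • f →
      TestSpace.M α f = ((sphereEigenvalue d k + ((d : ℝ) - 4 - α) / 2 * (((d : ℝ) + α) / 2) : ℝ)
        : ℂ) • f := by
    intro f hf
    rw [TestSpace.M_apply, hf, ← add_smul]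
    push_cast
    rfl
  have hself : ∀ u : TestSpace d (-4 - α), (inner ℂ u u : ℂ).re = ‖u‖ ^ 2 := fun u =>
    inner_self_eq_norm_sq (𝕜 := ℂ) u
  rw [TestSpace.T_harmonicBump hd k hη hs hn hη1, map_smul, map_smul,
    TestSpace.T_harmonicBump hd k hη1 hs1 hn hη2,
    hM _ (TestSpace.L_harmonicBump hd k hη hs hn),
    hM _ (TestSpace.L_harmonicBump hd k hη1 hs1 hn),
    TestSpace.L_harmonicBump hd k hη hs hn] at h
  simp only [inner_smul_left, inner_smul_right, Complex.conj_ofReal, Complex.re_ofReal_mul, hself,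
    norm_smul, Complex.norm_real, mul_pow, Real.norm_eq_abs, sq_abs] at h
  rw [TestSpace.norm_sq_harmonicBump hd k hη hs hn, TestSpace.norm_sq_harmonicBump hd k hη1 hs1 hn,
    TestSpace.norm_sq_harmonicBump hd k hη2 hs2 hn] at h
  -- Every squared norm was rescaled by the same factor `n`, which cancels.
  refine le_of_mul_le_mul_left (a := n) ?_ hn
  convert! h using 1 <;> ring

theorem le_of_forall_tested {C a b N₀ N₁ N₂ κ : ℝ} (hN₀ : 0 < N₀)
    (h : ∀ n : ℝ, 0 < n → C * ((n ^ 2)⁻¹ * N₁ + b * N₀) ≤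
      ((n ^ 2)⁻¹) ^ 2 * N₂ + κ * ((n ^ 2)⁻¹ * N₁) + a * N₀) : C * b ≤ a := by
  have ht : Filter.Tendsto (fun n : ℝ => (n ^ 2)⁻¹) Filter.atTop (nhds 0) :=
    (Filter.tendsto_pow_atTop two_ne_zero).inv_tendsto_atTop
  have h1 := (((ht.mul_const N₁).add_const (b * N₀)).const_mul C)
  have h2 := ((((ht.pow 2).mul_const N₂).add ((ht.mul_const N₁).const_mul κ)).add_const (a * N₀))
  have h3 := le_of_tendsto_of_tendsto h1 h2
    ((Filter.eventually_gt_atTop 0).mono fun n hn => h n hn)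
  norm_num at h3
  refine le_of_mul_le_mul_right (a := N₀) ?_ hN₀
  linarith

/-- With no zeroth-order term on either side, one divides by n⁻² before letting n → ∞; this detects
the coefficient of ‖T f‖². -/
theorem le_of_forall_tested_of_eq_zero {C N₁ N₂ κ : ℝ} (hN₁ : 0 < N₁)
    (h : ∀ n : ℝ, 0 < n → C * ((n ^ 2)⁻¹ * N₁) ≤
      ((n ^ 2)⁻¹) ^ 2 * N₂ + κ * ((n ^ 2)⁻¹ * N₁)) : C ≤ κ := by
  have ht : Filter.Tendsto (fun n : ℝ => (n ^ 2)⁻¹) Filter.atTop (nhds 0) :=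
    (Filter.tendsto_pow_atTop two_ne_zero).inv_tendsto_atTop
  have h2 := (ht.mul_const N₂).add_const (κ * N₁)
  have h3 := le_of_tendsto_of_tendsto (tendsto_const_nhds (x := C * N₁)) h2
    ((Filter.eventually_gt_atTop 0).mono fun n hn => by
      have hn' : (0 : ℝ) < (n ^ 2)⁻¹ := by positivity
      refine le_of_mul_le_mul_left (a := (n ^ 2)⁻¹) ?_ hn'
      have := h n hn
      change (n ^ 2)⁻¹ * (C * N₁) ≤ (n ^ 2)⁻¹ * ((n ^ 2)⁻¹ * N₂ + κ * N₁)
      nlinarith)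
  norm_num at h3
  exact le_of_mul_le_mul_right h3 hN₁

theorem le_hardyRellichConst_of_forall (hd : 2 ≤ d) {α C : ℝ}
    (hC : ∀ ψ : 𝔼 d → ℂ, IsTestAwayFromZero ψ →
      C * ∫ x, hardyIntegrand α ψ x ≤ ∫ x, rellichIntegrand α ψ x) :
    C ≤ hardyRellichConst d α := by
  refine le_hardyRellichConst hd (fun k => ?_) fun hα => ?_
  · obtain ⟨N₀, N₁, N₂, h0, -, h⟩ := exists_tested_inequality hd hC k
    exact le_of_forall_tested h0 h
  -- Radial test functions: with σ = 0 and k = 0 the `N₀` terms vanish, and κ = (α + 2)² = (d - 2)².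
  · obtain ⟨N₀, N₁, N₂, -, h1, h⟩ := exists_tested_inequality hd hC 0
    rw [show (d : ℝ) - 4 - α = 0 by linarith] at h
    have := le_of_forall_tested_of_eq_zero (C := C) (κ := (α + 2) ^ 2) (N₂ := N₂) h1 fun n hn => by
      simpa [sphereEigenvalue] using h n hn
    rwa [show α + 2 = d - 2 by linarith] at this

end Main

theorem corollary1p8 (d : ℕ) (hd : 2 ≤ d) :
    -- the infimum in the definition of `C(d, α)` is a minimum
    (∀ α : ℝ, (d : ℝ) - α - 4 ≠ 0 →
      IsLeast (Set.range (hardyRellichQuotient d α)) (hardyRellichConst d α)) ∧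
    -- the weighted Hardy-Rellich inequality, both integrals being finite
    (∀ (α : ℝ) (ψ : EuclideanSpace ℝ (Fin d) → ℂ), IsTestAwayFromZero ψ →
      Integrable (rellichIntegrand α ψ) ∧ Integrable (hardyIntegrand α ψ) ∧
      hardyRellichConst d α * ∫ x, hardyIntegrand α ψ x ≤ ∫ x, rellichIntegrand α ψ x) ∧
    -- the constant is optimal
    (∀ α C : ℝ, (∀ ψ : EuclideanSpace ℝ (Fin d) → ℂ, IsTestAwayFromZero ψ →
      C * ∫ x, hardyIntegrand α ψ x ≤ ∫ x, rellichIntegrand α ψ x) →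
      C ≤ hardyRellichConst d α) ∧
    -- in the unweighted case it takes the classical values
    (d = 2 → hardyRellichConst d 0 = 0) ∧
    (d = 3 → hardyRellichConst d 0 = 25 / 36) ∧
    (d = 4 → hardyRellichConst d 0 = 3) ∧
    (5 ≤ d → hardyRellichConst d 0 = (d : ℝ) ^ 2 / 4) := by
  refine ⟨fun α hα => isLeast_hardyRellichConst hd hα, fun α ψ hψ => ?_,
    fun α C hC => le_hardyRellichConst_of_forall hd hC, ?_, ?_, ?_, hardyRellichConst_of_five_le⟩
  · exact ⟨TestSpace.integrable_rellich α (.of _ ψ hψ), TestSpace.integrable_hardy α (.of _ ψ hψ),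
      TestSpace.mul_integral_hardy_le hd (hardyRellichConst_le_add hd)
        (hardyRellichConst_mul_le hd) (.of _ ψ hψ)⟩
  · rintro rfl
    exact hardyRellichConst_two
  · rintro rfl
    exact hardyRellichConst_three
  · rintro rfl
    exact hardyRellichConst_four
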